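/- Let $\ell \ge 2$ (even or odd) and let $G$ be a connected semisimple complex group of type $A_{\ell-1}$, that is, $G = \pi(\mathrm{SL}_\ell(\mathbb C))$ for a surjective homomorphism $\pi$ with kernel contained in the centre of $\mathrm{SL}_\ell(\mathbb C)$. Let $A \le G$ be the image of the diagonal torus and $\tilde W = N_G(A)/A$ the Weyl group, with simple roots $\gamma_k = e_k - e_{k+1}$ and simple reflections $w_k$ ($1 \le k < \ell$). An element of $\tilde W$ is elliptic if its conjugacy class meets no subgroup $\langle w_k : k \in \theta\rangle$ with $\theta \subsetneq \{1,\dots,\ell-1\}$. Identify $V = X_*(A)\otimes\mathbb R$ with $\{x \in \mathbb R^\ell : \sum x_i = 0\}$, let $\check\omega_k = e_1+\dots+e_k-\frac{k}{\ell}(e_1+\dots+e_\ell)$ be the fundamental coweights, and let $C = \{x \in V : 0 < x_i - x_j < 1 \text{ for } i<j\}$ be the fundamental alcove. Write the highest root as $\sum_k c_k\gamma_k$, define $b_k$ by $\check\omega_k(\gamma_j) = \frac{b_k}{c_k}\delta_{kj}$ for $1\le k,j<\ell$, and put $b_0 = 1$ for the affine node $\gamma_0 = 1 - \sum_k c_k\gamma_k$.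 The vertices of $C$ are $v_0 = 0$ and $v_k = \check\omega_k/b_k$. For $g \in G$ of finite order $m$ and a primitive $m$-th root of unity $\xi$, a Kac diagram of $g$ is a labelling $(s_0,\dots,s_{\ell-1})$ of the nodes $\gamma_0,\dots,\gamma_{\ell-1}$ of the affine Dynkin diagram by non-negative integers obtained as follows: choose a cocharacter $\lambda \in X_*(A)$ such that $g$ is $G$-conjugate to $\lambda(\xi)$ and $\lambda/m$ lies in the closure of $C$; write $\lambda/m = \frac1m\sum_{k=0}^{\ell-1} s'_k b_k v_k$ with $s'_k \in \mathbb Z_{\ge 0}$ and $m = \sum_{k=0}^{\ell-1} s'_k b_k$; and divide the $s'_k$ by their greatest common divisor. Then: (1) the elliptic elements of $\tilde W$ form exactly one conjugacy class, namely that of the Coxeter element $w_1w_2\cdots w_{\ell-1}$. (2) $b_k = 1$ for all $0 \le k < \ell$. (3) Every lift $n \in N_G(A)$ of an elliptic element of $\tilde W$ has finite order, and for every choice of $\xi$ it has exactly one Kac diagram, whatever choice of $\lambda$ is made; this diagram is the diagram of the $b_k$, that is, all its labels are $1$. -/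

import Mathlib

open scoped MatrixGroups

noncomputable section

namespace KacA

/-! ### The simply connected group `SL_ℓ(ℂ)`, its diagonal torus, and the elements `s_k`

Simple roots are indexed by `Fin (ℓ - 1)`; the index `k` stands for the pair of consecutive
coordinates `lo k`, `hi k`, that is, for the root `e_{lo k} - e_{hi k}`. -/

/-- The first coordinate of the simple root with index `k`. -/
def lo {ℓ : ℕ} (k : Fin (ℓ - 1)) : Fin ℓ := ⟨k, by omega⟩

/-- The second coordinate of the simple root with index `k`. -/
def hi {ℓ : ℕ} (k : Fin (ℓ - 1)) : Fin ℓ := ⟨k + 1, by omega⟩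

theorem lo_ne_hi {ℓ : ℕ} (k : Fin (ℓ - 1)) : lo k ≠ hi k := by
  simp [lo, hi, Fin.ext_iff]

/-- Tuples of non-zero complex numbers with product one. -/
def tuples (ℓ : ℕ) : Subgroup (Fin ℓ → ℂˣ) where
  carrier := {t | ∏ i, t i = 1}
  one_mem' := by simp
  mul_mem' := by
    intro a b ha hb
    simp only [Set.mem_ofPred_eq, Pi.mul_apply, Finset.prod_mul_distrib] at *
    rw [ha, hb, one_mul]
  inv_mem' := by
    intro a ha
    simp only [Set.mem_ofPred_eq, Pi.inv_apply, Finset.prod_inv_distrib] at *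
    rw [ha, inv_one]

/-- The diagonal matrix in `SL_ℓ(ℂ)` with the given entries. -/
def diag (ℓ : ℕ) : tuples ℓ →* SL(ℓ, ℂ) where
  toFun t := ⟨Matrix.diagonal fun i => ((t.1 i : ℂˣ) : ℂ), by
    have h : ∏ i, t.1 i = 1 := t.2
    rw [Matrix.det_diagonal, ← Units.coe_prod, h, Units.val_one]⟩
  map_one' := by
    ext i j
    simp [Matrix.one_apply, Matrix.diagonal_apply]
  map_mul' := by
    intro a b
    apply Subtype.ext
    change Matrix.diagonal _ = Matrix.diagonal _ * Matrix.diagonal _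
    rw [Matrix.diagonal_mul_diagonal]
    simp

/-- The matrix `s_k`: it agrees with the identity outside the rows `k`, `k + 1`, and has
the entry `1` at `(k, k + 1)` and the entry `-1` at `(k + 1, k)`. -/
def sMatrix {ℓ : ℕ} (k : Fin (ℓ - 1)) : Matrix (Fin ℓ) (Fin ℓ) ℂ := fun i j =>
  if i = j ∧ i ≠ lo k ∧ i ≠ hi k then 1
  else if i = lo k ∧ j = hi k then 1
  else if i = hi k ∧ j = lo k then -1
  else 0

theorem sMatrix_eq {ℓ : ℕ} (k : Fin (ℓ - 1)) :
    sMatrix k = Matrix.transvection (lo k) (hi k) 1 * Matrix.transvection (hi k) (lo k) (-1) *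
      Matrix.transvection (lo k) (hi k) 1 := by
  have h := lo_ne_hi k
  ext i j
  simp only [Matrix.transvection, add_mul, mul_add, one_mul, mul_one,
    Matrix.single_mul_single_same, Matrix.single_mul_single_of_ne _ _ _ _ h.symm]
  simp only [Matrix.add_apply, Matrix.zero_apply, Matrix.one_apply, Matrix.single_apply, sMatrix]
  grind

theorem det_sMatrix {ℓ : ℕ} (k : Fin (ℓ - 1)) : (sMatrix k).det = 1 := by
  rw [sMatrix_eq, Matrix.det_mul, Matrix.det_mul,
    Matrix.det_transvection_of_ne _ _ (lo_ne_hi k),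
    Matrix.det_transvection_of_ne _ _ (lo_ne_hi k).symm]
  simp

/-- The element `s_k` of `SL_ℓ(ℂ)`. -/
def s {ℓ : ℕ} (k : Fin (ℓ - 1)) : SL(ℓ, ℂ) := ⟨sMatrix k, det_sMatrix k⟩

/-- Interchanging the entries `k` and `k + 1` of a tuple. -/
def swapTuple {ℓ : ℕ} (k : Fin (ℓ - 1)) (t : tuples ℓ) : tuples ℓ :=
  ⟨fun i => t.1 (Equiv.swap (lo k) (hi k) i), by
    have h : ∏ i, t.1 i = 1 := t.2
    change ∏ i, t.1 (Equiv.swap (lo k) (hi k) i) = 1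
    rw [Equiv.prod_comp (Equiv.swap (lo k) (hi k)) t.1, h]⟩

theorem s_mul_diag {ℓ : ℕ} (k : Fin (ℓ - 1)) (t : tuples ℓ) :
    s k * diag ℓ t = diag ℓ (swapTuple k t) * s k := by
  have h := lo_ne_hi k
  apply Subtype.ext
  change sMatrix k * Matrix.diagonal _ = Matrix.diagonal _ * sMatrix k
  ext i j
  simp only [Matrix.mul_diagonal, Matrix.diagonal_mul, swapTuple, sMatrix, Equiv.swap_apply_def]
  grind

/-! ### The group `G`

Let `π : SL_ℓ(ℂ) → G` be surjective with central kernel. -/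

section group

variable {ℓ : ℕ} {G : Type*} [Group G]

/-- The parametrization of the maximal torus of `G` by tuples. -/
def param (π : SL(ℓ, ℂ) →* G) : tuples ℓ →* G := π.comp (diag ℓ)

/-- The maximal torus `A` of `G`: the image of the diagonal matrices. -/
def A (π : SL(ℓ, ℂ) →* G) : Subgroup G := (param π).range

/-- The normalizer `N_G(A)`. -/
abbrev N (π : SL(ℓ, ℂ) →* G) : Subgroup G := Subgroup.normalizer (A π : Set G)

/-- The Weyl group `N_G(A) / A`. -/
abbrev W (π : SL(ℓ, ℂ) →* G) : Type _ := N π ⧸ (A π).subgroupOf (N π)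

theorem map_s_mem (π : SL(ℓ, ℂ) →* G) (k : Fin (ℓ - 1)) : π (s k) ∈ N π := by
  have key : ∀ t, π (s k) * param π t * (π (s k))⁻¹ = param π (swapTuple k t) := by
    intro t
    rw [mul_inv_eq_iff_eq_mul]
    simp only [param, MonoidHom.comp_apply, ← map_mul, s_mul_diag]
  rw [Subgroup.mem_normalizer_iff]
  intro h
  constructor
  · rintro ⟨t, rfl⟩
    exact ⟨swapTuple k t, (key t).symm⟩
  · rintro ⟨t, ht⟩
    refine ⟨swapTuple k t, ?_⟩
    have hsw : swapTuple k (swapTuple k t) = t := by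
      apply Subtype.ext
      funext i
      simp [swapTuple]
    have h2 := key (swapTuple k t)
    rw [hsw, ht] at h2
    exact mul_left_cancel (mul_right_cancel h2)

/-- The simple reflection `w_k` in the Weyl group. -/
def simpleReflection (π : SL(ℓ, ℂ) →* G) (k : Fin (ℓ - 1)) : W π :=
  QuotientGroup.mk ⟨π (s k), map_s_mem π k⟩

/-- The standard parabolic subgroup of the Weyl group attached to a set of simple roots. -/
def parabolic (π : SL(ℓ, ℂ) →* G) (θ : Set (Fin (ℓ - 1))) : Subgroup (W π) :=
  Subgroup.closure (simpleReflection π '' θ)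

/-- An element of the Weyl group is elliptic if its conjugacy class meets no standard parabolic
subgroup attached to a proper subset of the simple roots. -/
def IsElliptic (π : SL(ℓ, ℂ) →* G) (w : W π) : Prop :=
  ∀ θ : Set (Fin (ℓ - 1)), θ ≠ Set.univ → ∀ u : W π, IsConj w u → u ∉ parabolic π θ

/-- The Coxeter element `w_1 w_2 ⋯ w_{ℓ-1}`. -/
def coxeterElement (π : SL(ℓ, ℂ) →* G) : W π :=
  (List.ofFn (simpleReflection π)).prod

/-! ### Characters and cocharacters of `A`

The space `V = X_*(A) ⊗ ℝ` is identified with the hyperplane `∑ x_i = 0` of `ℝ^ℓ`. -/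

/-- `χ` is the algebraic character of `A` that sends the class of `diag(t_1, …, t_ℓ)`
to `∏ t_i ^ e_i`. -/
def IsCharacter (π : SL(ℓ, ℂ) →* G) (χ : A π →* ℂˣ) (e : Fin ℓ → ℤ) : Prop :=
  ∀ t : tuples ℓ, χ ((param π).rangeRestrict t) = ∏ i, t.1 i ^ e i

/-- `c : ℂˣ → A` is an algebraic cocharacter: its composite with every algebraic character
of `A` is of the form `z ↦ z ^ k`. -/
def IsCocharacter (π : SL(ℓ, ℂ) →* G) (c : ℂˣ →* A π) : Prop :=
  ∀ χ e, IsCharacter π χ e → ∃ k : ℤ, ∀ z, χ (c z) = z ^ k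

/-- `v` is the vector of `V` that corresponds to the cocharacter `c`: the pairing of `c`
with a character is the dot product of `v` with the exponents of this character. -/
def IsVectorOf (π : SL(ℓ, ℂ) →* G) (c : ℂˣ →* A π) (v : Fin ℓ → ℝ) : Prop :=
  ∑ i, v i = 0 ∧
    ∀ χ e (k : ℤ), IsCharacter π χ e → (∀ z, χ (c z) = z ^ k) → ∑ i, (e i : ℝ) * v i = k

end group

/-! ### Roots, coweights, the alcove and the constants `b_γ` -/

/-- The vector `e_i - e_j`. -/
def rootVec {ℓ : ℕ} (i j : Fin ℓ) : Fin ℓ → ℤ := Pi.single i 1 - Pi.single j 1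

/-- The simple root with index `k`. -/
def simpleRoot {ℓ : ℕ} (k : Fin (ℓ - 1)) : Fin ℓ → ℤ := rootVec (lo k) (hi k)

/-- The roots are the vectors `e_i - e_j` with `i ≠ j`. -/
def IsRoot {ℓ : ℕ} (β : Fin ℓ → ℤ) : Prop := ∃ i j, i ≠ j ∧ β = rootVec i j

/-- The highest root: it differs from every root by a non-negative combination of
simple roots. -/
def IsHighestRoot {ℓ : ℕ} (β : Fin ℓ → ℤ) : Prop :=
  IsRoot β ∧ ∀ ρ, IsRoot ρ → ∃ a : Fin (ℓ - 1) → ℕ, β - ρ = ∑ k, (a k : ℤ) • simpleRoot k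

/-- The fundamental coweight `e_1 + ⋯ + e_k - (k / ℓ) (e_1 + ⋯ + e_ℓ)` (with `k` counted
from one). -/
def coweight {ℓ : ℕ} (k : Fin (ℓ - 1)) : Fin ℓ → ℝ := fun i =>
  (if i ≤ lo k then 1 else 0) - ((k : ℝ) + 1) / ℓ

/-- The nodes of the affine Dynkin diagram: `some k` is the simple root with index `k`, and
`none` is the affine root `γ_0 = 1 - (highest root)`. -/
abbrev Node (ℓ : ℕ) : Type := Option (Fin (ℓ - 1))

/-- `b` is the labelling of the nodes by the constants `b_γ`: `b_{γ_0} = 1`, and for a simple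
root `γ`, with `c_γ` the coefficient of `γ` in the highest root, the coweight of `γ` takes the
value `b_γ / c_γ` on `γ` and `0` on the other simple roots. -/
def IsB {ℓ : ℕ} (b : Node ℓ → ℕ) : Prop :=
  b none = 1 ∧ ∃ c : Fin (ℓ - 1) → ℕ, (∀ k, 0 < c k) ∧
    IsHighestRoot (∑ k, (c k : ℤ) • simpleRoot k) ∧
    ∀ k j, ∑ i, (simpleRoot j i : ℝ) * coweight k i =
      if k = j then (b (some k) : ℝ) / c k else 0

/-- The fundamental alcove `C`: the points of `V` at which every positive root `e_i - e_j`,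
`i < j`, takes a value strictly between `0` and `1`. -/
def alcove (ℓ : ℕ) : Set (Fin ℓ → ℝ) :=
  {x | ∑ i, x i = 0 ∧ ∀ i j, i < j → 0 < x i - x j ∧ x i - x j < 1}

/-- The vertices of the alcove: `v_{γ_0} = 0`, and `v_γ` is the coweight of `γ` divided
by `b_γ`. -/
def vertex {ℓ : ℕ} (b : Node ℓ → ℕ) : Node ℓ → Fin ℓ → ℝ
  | none => 0
  | some k => (b (some k) : ℝ)⁻¹ • coweight k

/-- `σ` is a Kac diagram of the element `g` of `G`, relative to the root of unity `ξ` (which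
has to be primitive of order `m = orderOf g`).  There is a cocharacter `c` of `A` such that `g`
is conjugate to `c ξ` and `x = c / m` lies in the closure of the alcove, and there are
non-negative integers `τ γ` with `m = ∑ τ γ * b γ` and `x = (1 / m) ∑ τ γ * b γ * v_γ`, from which
`σ` arises by removing the common factor. -/
def IsKacDiagram {ℓ : ℕ} {G : Type*} [Group G] (π : SL(ℓ, ℂ) →* G) (b : Node ℓ → ℕ)
    (ξ : ℂˣ) (g : G) (σ : Node ℓ → ℕ) : Prop :=
  ∃ (c : ℂˣ →* A π) (v x : Fin ℓ → ℝ) (τ : Node ℓ → ℕ),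
    IsCocharacter π c ∧ IsVectorOf π c v ∧
    IsConj g (c ξ : G) ∧
    x = (orderOf g : ℝ)⁻¹ • v ∧ x ∈ closure (alcove ℓ) ∧
    orderOf g = ∑ γ, τ γ * b γ ∧
    x = (orderOf g : ℝ)⁻¹ • ∑ γ, ((τ γ * b γ : ℕ) : ℝ) • vertex b γ ∧
    (∃ d : ℕ, 0 < d ∧ ∀ γ, τ γ = d * σ γ) ∧ Finset.univ.gcd σ = 1

end KacA

end

namespace KacA

/-! ### Elliptic elements of the symmetric group -/

/-! The kernel of `π` consists of scalar matrices, so `N_G(A)` is the image of the monomial matrices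
and the Weyl group is the symmetric group (`weylEquiv`). A parabolic subgroup that omits the node
`k` preserves an initial segment of the coordinates, and a permutation with a proper invariant set
can be conjugated to preserve such a segment. Hence elliptic means full `ℓ`-cycle, which is one
conjugacy class. All coefficients of the highest root are `1`, hence so are the `b_γ`.

For a monomial matrix `M` over an `ℓ`-cycle, `M ^ ℓ` is a scalar, and all `ℓ`-th roots of this
scalar are eigenvalues. The determinant then forces `M ^ ℓ = (-1) ^ (ℓ - 1)` (`IsMonomial.pow_eq`),
so the spectrum is the same for all lifts. The order of a lift in `G` is `ℓ * d` for some `d`.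

Uniqueness: if the lift is conjugate to `λ(ξ)`, the label `τ_k` of a simple root is the exponent of
`ξ` in a ratio of two eigenvalues. Such ratios are nontrivial `ℓ`-th roots of unity, so `d ∣ τ_k`
and `τ_k ≠ 0`. The ratio of the extreme eigenvalues gives `τ_0 ≠ 0`. There are `ℓ` positive
multiples of `d` with sum `ℓ * d`, so all are `d`. Existence: the cocharacter `d ρ^∨`, with `ρ^∨`
the half sum of the positive coroots, has all labels equal to `d`. It may fail to lift to `SL_ℓ`,
but it is defined on `A` (`exists_cocharacter`). -/

/-- A permutation all of whose points lie in a single cycle. -/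
def IsFullCycle {ℓ : ℕ} (p : Equiv.Perm (Fin ℓ)) : Prop := ∀ i j, p.SameCycle i j

theorem IsFullCycle.apply_ne {ℓ : ℕ} (hℓ : 2 ≤ ℓ) {p : Equiv.Perm (Fin ℓ)} (hp : IsFullCycle p)
    (i : Fin ℓ) : p i ≠ i := by
  intro hi
  have : Nontrivial (Fin ℓ) := Fin.nontrivial_iff_two_le.2 hℓ
  obtain ⟨j, hj⟩ := exists_ne i
  obtain ⟨k, hk⟩ := hp i j
  exact hj (by rw [← hk, Equiv.Perm.zpow_apply_eq_self_of_apply_eq_self hi])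

theorem IsFullCycle.isCycle {ℓ : ℕ} (hℓ : 2 ≤ ℓ) {p : Equiv.Perm (Fin ℓ)} (hp : IsFullCycle p) :
    p.IsCycle :=
  ⟨⟨0, by omega⟩, hp.apply_ne hℓ _, fun j _ => hp _ j⟩

theorem IsFullCycle.card_support {ℓ : ℕ} (hℓ : 2 ≤ ℓ) {p : Equiv.Perm (Fin ℓ)}
    (hp : IsFullCycle p) : p.support.card = ℓ := by
  have : p.support = Finset.univ := by
    ext i
    simpa using hp.apply_ne hℓ i
  simp [this]

theorem IsFullCycle.orderOf {ℓ : ℕ} (hℓ : 2 ≤ ℓ) {p : Equiv.Perm (Fin ℓ)}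
    (hp : IsFullCycle p) : orderOf p = ℓ := by
  rw [(hp.isCycle hℓ).orderOf, hp.card_support hℓ]

theorem isFullCycle_of_isCycle {ℓ : ℕ} {p : Equiv.Perm (Fin ℓ)} (hp : p.IsCycle)
    (hs : p.support.card = ℓ) : IsFullCycle p := by
  have h : p.support = Finset.univ := by
    rw [← Finset.card_eq_iff_eq_univ, hs, Fintype.card_fin]
  intro i j
  refine hp.sameCycle ?_ ?_ <;> rw [← Equiv.Perm.mem_support, h] <;> simp

theorem IsFullCycle.isConj_iff {ℓ : ℕ} (hℓ : 2 ≤ ℓ) {p q : Equiv.Perm (Fin ℓ)}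
    (hp : IsFullCycle p) : IsConj p q ↔ IsFullCycle q := by
  constructor
  · intro h
    have hc := Equiv.Perm.isConj_iff_cycleType_eq.1 h
    have hq : q.IsCycle := by
      rw [← Equiv.Perm.card_cycleType_eq_one, ← hc, Equiv.Perm.card_cycleType_eq_one]
      exact hp.isCycle hℓ
    refine isFullCycle_of_isCycle hq ?_
    rw [← Equiv.Perm.sum_cycleType, ← hc, Equiv.Perm.sum_cycleType, hp.card_support hℓ]
  · intro hq
    rw [(hp.isCycle hℓ).isConj_iff (hq.isCycle hℓ), hp.card_support hℓ, hq.card_support hℓ]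

/-- The transposition of the coordinates `lo k`, `hi k`. -/
def adjSwap {ℓ : ℕ} (k : Fin (ℓ - 1)) : Equiv.Perm (Fin ℓ) := Equiv.swap (lo k) (hi k)

/-- `formPerm` of the list `0, …, ℓ - 1` is by definition this product of adjacent transpositions.
-/
theorem isFullCycle_prod_adjSwap {ℓ : ℕ} (hℓ : 2 ≤ ℓ) :
    IsFullCycle (List.ofFn (adjSwap (ℓ := ℓ))).prod := by
  have h : List.ofFn (adjSwap (ℓ := ℓ)) =
      List.zipWith Equiv.swap (List.finRange ℓ) (List.finRange ℓ).tail := by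
    apply List.ext_getElem
    · simp
    · intro i h1 h2
      simp [adjSwap, lo, hi]
  have h' : (List.ofFn (adjSwap (ℓ := ℓ))).prod = (List.finRange ℓ).formPerm := by
    rw [h]; rfl
  have hn := List.nodup_finRange ℓ
  rw [h']
  apply isFullCycle_of_isCycle
  · exact List.isCycle_formPerm hn (by simpa using hℓ)
  · rw [List.support_formPerm_of_nodup _ hn, List.toFinset_card_of_nodup hn, List.length_finRange]
    intro x hx
    have := congrArg List.length hx
    simp at this
    omega

theorem adjSwap_apply_le_iff {ℓ : ℕ} {k j : Fin (ℓ - 1)} (h : j ≠ k) (i : Fin ℓ) :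
    adjSwap j i ≤ lo k ↔ i ≤ lo k := by
  unfold adjSwap
  rw [Equiv.swap_apply_def]
  simp only [lo, hi, Fin.ext_iff, Fin.le_def] at *
  split_ifs <;> simp_all <;> omega

theorem exists_invariant_of_not_isFullCycle {ℓ : ℕ} {p : Equiv.Perm (Fin ℓ)}
    (hp : ¬ IsFullCycle p) :
    ∃ S : Finset (Fin ℓ), S.Nonempty ∧ S ≠ Finset.univ ∧ ∀ i, p i ∈ S ↔ i ∈ S := by
  classical
  simp only [IsFullCycle, not_forall] at hp
  obtain ⟨i, j, hij⟩ := hp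
  refine ⟨Finset.univ.filter fun x => p.SameCycle i x,
    ⟨i, by simp [Equiv.Perm.SameCycle.refl]⟩, fun h => hij ?_, by simp⟩
  simpa using (Finset.ext_iff.1 h j)

/-- A group generated by transpositions contains every permutation that preserves its orbits. Here
each side of the cut after `lo k` lies in one orbit, because adjacent swaps connect it. -/
theorem mem_closure_adjSwap {ℓ : ℕ} {k : Fin (ℓ - 1)} {p : Equiv.Perm (Fin ℓ)}
    (hp : ∀ i, p i ≤ lo k ↔ i ≤ lo k) :
    p ∈ Subgroup.closure (adjSwap '' {k}ᶜ) := by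
  rw [mem_closure_isSwap]
  swap
  · rintro _ ⟨j, -, rfl⟩
    exact ⟨_, _, lo_ne_hi j, rfl⟩
  refine ⟨Set.toFinite _, fun x => ?_⟩
  set H := Subgroup.closure (adjSwap '' ({k}ᶜ : Set (Fin (ℓ - 1))))
  have key : ∀ (d : ℕ) (a b : Fin ℓ), (b : ℕ) = a + d → (a ≤ lo k ↔ b ≤ lo k) →
      b ∈ MulAction.orbit H a := by
    intro d
    induction d with
    | zero =>
      intro a b hab _
      have : b = a := Fin.ext (by simpa using hab)
      rw [this]
      exact MulAction.mem_orbit_self a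
    | succ d ih =>
      intro a b hab h
      -- The last step of the walk from `a` to `b` is the swap `j`. It is not the omitted one, since
      -- `a` and `b` lie on the same side of the cut.
      let j : Fin (ℓ - 1) := ⟨a + d, by omega⟩
      have hj : j ≠ k := by
        rintro rfl
        simp only [lo, Fin.le_def, j] at h
        omega
      have hb : b = adjSwap j (lo j) := by
        rw [adjSwap, Equiv.swap_apply_left]
        exact Fin.ext (by simp [hi, j]; omega)
      have h2 : (a ≤ lo k ↔ lo j ≤ lo k) := by
        rw [h, hb, adjSwap_apply_le_iff hj]
      have h1 := ih a (lo j) rfl h2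
      rw [hb, ← MulAction.orbit_eq_iff.2 h1]
      exact ⟨⟨adjSwap j, Subgroup.subset_closure ⟨j, hj, rfl⟩⟩, rfl⟩
  rcases le_total x (p x) with h | h
  · exact key (p x - x) x (p x) (by rw [Fin.le_def] at h; omega) (hp x).symm
  · rw [← MulAction.orbit_eq_iff]
    exact (MulAction.orbit_eq_iff.2
      (key (x - p x) (p x) x (by rw [Fin.le_def] at h; omega) (hp x))).symm

theorem closure_adjSwap (ℓ : ℕ) :
    Subgroup.closure (Set.range (adjSwap (ℓ := ℓ))) = ⊤ := by
  match ℓ with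
  | 0 => exact Subsingleton.elim _ _
  | 1 => exact Subsingleton.elim _ _
  | n + 2 =>
    rw [eq_top_iff]
    intro p _
    have := Equiv.Perm.mclosure_swap_castSucc_succ (n + 1)
    have hp : p ∈ Submonoid.closure (Set.range fun i : Fin (n + 1) =>
      Equiv.swap i.castSucc i.succ) := by rw [this]; trivial
    exact Subgroup.le_closure_toSubmonoid _ hp

theorem isFullCycle_iff_forall_conj {ℓ : ℕ} (p : Equiv.Perm (Fin ℓ)) (hℓ : 2 ≤ ℓ) :
    IsFullCycle p ↔ ∀ θ : Set (Fin (ℓ - 1)), θ ≠ Set.univ → ∀ u, IsConj p u →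
      u ∉ Subgroup.closure (adjSwap '' θ) := by
  constructor
  · intro hp θ hθ u hu hmem
    have hu' : IsFullCycle u := (hp.isConj_iff hℓ).1 hu
    obtain ⟨k, hk⟩ := (Set.ne_univ_iff_exists_notMem θ).1 hθ
    -- The stabilizer of the initial segment contains the parabolic subgroup, but a full cycle has a
    -- power that carries `lo k` to `hi k`, out of the segment.
    let K : Subgroup (Equiv.Perm (Fin ℓ)) :=
      { carrier := {q | ∀ i, q i ≤ lo k ↔ i ≤ lo k}
        one_mem' := fun i => Iff.rfl
        mul_mem' := fun {a b} ha hb i => (ha (b i)).trans (hb i)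
        inv_mem' := fun {a} ha i => by
          have := ha (a⁻¹ i)
          simpa using this.symm }
    have hle : Subgroup.closure (adjSwap '' θ) ≤ K := by
      rw [Subgroup.closure_le]
      rintro _ ⟨j, hj, rfl⟩ i
      exact adjSwap_apply_le_iff (by rintro rfl; exact hk hj) i
    obtain ⟨z, hz⟩ := hu' (lo k) (hi k)
    have := (K.zpow_mem (hle hmem) z) (lo k)
    rw [hz] at this
    simp [lo, hi, Fin.le_def] at this
  · intro h
    by_contra hp
    obtain ⟨S, hne, hS, hinv⟩ := exists_invariant_of_not_isFullCycle hp
    have hc1 : 0 < S.card := hne.card_pos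
    have hc2 : S.card < ℓ := by
      simpa using (Finset.card_lt_iff_ne_univ S).2 hS
    -- Indices start at zero, so the segment up to `lo k` has exactly `S.card` elements and some
    -- permutation carries `S` onto it.
    let k : Fin (ℓ - 1) := ⟨S.card - 1, by omega⟩
    have hcard : Fintype.card {i // i ∈ S} = Fintype.card {i : Fin ℓ // i ≤ lo k} := by
      rw [Fintype.card_coe, Fintype.card_subtype]
      have : (Finset.univ.filter fun i : Fin ℓ => i ≤ lo k) = Finset.Iic (lo k) := by ext; simp
      rw [this, Fin.card_Iic]
      simp [lo, k]
      omega
    let e : {i // i ∈ S} ≃ {i : Fin ℓ // i ≤ lo k} := Fintype.equivOfCardEq hcard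
    let g : Equiv.Perm (Fin ℓ) := e.extendSubtype
    have hg : ∀ i, g i ≤ lo k ↔ i ∈ S := by
      intro i
      constructor
      · intro hi
        by_contra hiS
        exact e.extendSubtype_not_mem i hiS hi
      · exact e.extendSubtype_mem i
    refine h {k}ᶜ (by simp) (g * p * g⁻¹) (isConj_iff.2 ⟨g, rfl⟩) (mem_closure_adjSwap fun i => ?_)
    simp only [Equiv.Perm.mul_apply]
    rw [hg, hinv, ← hg]
    simp

/-! ### Monomial matrices and the Weyl group -/

/-- The coefficients `ℓ - 1, ℓ - 3, …, 1 - ℓ` of the sum of the positive coroots. -/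
def twoRho {ℓ : ℕ} (i : Fin ℓ) : ℤ := ℓ - 1 - 2 * (i : ℤ)

theorem sum_twoRho (ℓ : ℕ) : ∑ i : Fin ℓ, twoRho i = 0 := by
  have h : ∑ i : Fin ℓ, twoRho i = ∑ i : Fin ℓ, -twoRho i := by
    rw [← Equiv.sum_comp Fin.revPerm]
    refine Finset.sum_congr rfl fun i _ => ?_
    simp only [twoRho, Fin.revPerm_apply, Fin.val_rev]
    omega
  rw [Finset.sum_neg_distrib] at h
  omega

theorem prod_zpow_sum {ι : Type*} (s : Finset ι) (y : ℂˣ) (f : ι → ℤ) :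
    ∏ i ∈ s, y ^ f i = y ^ ∑ i ∈ s, f i := by
  classical
  induction s using Finset.induction_on with
  | empty => simp
  | insert a s ha ih => rw [Finset.prod_insert ha, Finset.sum_insert ha, zpow_add, ih]

/-- The tuple with entries `y ^ (d * twoRho i)`. -/
def rhoTuple (ℓ : ℕ) (d : ℤ) : ℂˣ →* tuples ℓ where
  toFun y := ⟨fun i => y ^ (d * twoRho i), by
    change ∏ i, y ^ (d * twoRho i) = 1
    rw [prod_zpow_sum, ← Finset.mul_sum, sum_twoRho, mul_zero, zpow_zero]⟩
  map_one' := by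
    apply Subtype.ext
    funext i
    simp
  map_mul' a b := by
    apply Subtype.ext
    funext i
    simp [mul_zpow]

theorem rhoTuple_apply {ℓ : ℕ} (d : ℤ) (y : ℂˣ) (i : Fin ℓ) :
    (rhoTuple ℓ d y).1 i = y ^ (d * twoRho i) := rfl

/-- A regular element of the torus, which forces a normalizing matrix to be monomial. Its entries
are distinct powers of `2`. -/
theorem exists_injective_tuple (ℓ : ℕ) : ∃ t : tuples ℓ, Function.Injective t.1 := by
  refine ⟨rhoTuple ℓ 1 (Units.mk0 2 two_ne_zero), fun i j h => ?_⟩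
  rw [rhoTuple_apply, rhoTuple_apply] at h
  have h2 := congrArg (fun u : ℂˣ => ‖(u : ℂ)‖) h
  simp only [Units.val_zpow_eq_zpow_val, Units.val_mk0, norm_zpow, one_mul] at h2
  have h3 := zpow_right_injective₀ (by simp) (by simp) h2
  simp only [twoRho] at h3
  exact Fin.ext (by omega)

theorem diag_apply {ℓ : ℕ} (t : tuples ℓ) :
    ((diag ℓ t : SL(ℓ, ℂ)) : Matrix (Fin ℓ) (Fin ℓ) ℂ) =
      Matrix.diagonal fun i => ((t.1 i : ℂˣ) : ℂ) := rfl

/-- The matrix `M` is monomial, with the non-zero entries in the places `(p j, j)`. -/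
def IsMonomial {ℓ : ℕ} (M : SL(ℓ, ℂ)) (p : Equiv.Perm (Fin ℓ)) : Prop :=
  ∀ i j, M.1 i j ≠ 0 ↔ i = p j

theorem IsMonomial.unique {ℓ : ℕ} {M : SL(ℓ, ℂ)} {p q : Equiv.Perm (Fin ℓ)}
    (hp : IsMonomial M p) (hq : IsMonomial M q) : p = q := by
  ext j : 1
  exact (hq _ j).1 ((hp _ j).2 rfl)

theorem IsMonomial.mul {ℓ : ℕ} {M M' : SL(ℓ, ℂ)} {p q : Equiv.Perm (Fin ℓ)}
    (hp : IsMonomial M p) (hq : IsMonomial M' q) : IsMonomial (M * M') (p * q) := by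
  intro i j
  have h : (M * M').1 i j = M.1 i (q j) * M'.1 (q j) j := by
    change (M.1 * M'.1) i j = _
    rw [Matrix.mul_apply]
    refine Finset.sum_eq_single _ (fun k _ hk => ?_) (by simp)
    rw [not_not.1 (mt (hq k j).1 hk), mul_zero]
  rw [h, mul_ne_zero_iff, hp, hq]
  simp

theorem isMonomial_diag {ℓ : ℕ} (t : tuples ℓ) : IsMonomial (diag ℓ t) 1 := by
  intro i j
  rw [diag_apply, Matrix.diagonal_apply]
  simp

theorem IsMonomial.exists_diag {ℓ : ℕ} {M : SL(ℓ, ℂ)} (h : IsMonomial M 1) :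
    ∃ t, M = diag ℓ t := by
  have hM : M.1 = Matrix.diagonal fun i => M.1 i i := by
    ext i j
    rw [Matrix.diagonal_apply]
    split_ifs with hij
    · rw [hij]
    · exact not_not.1 (mt (h i j).1 hij)
  have hdet : ∏ i, M.1 i i = 1 := by
    rw [← Matrix.det_diagonal, ← hM]
    exact M.2
  refine ⟨⟨fun i => Units.mk0 (M.1 i i) ((h i i).2 rfl), ?_⟩, Subtype.ext ?_⟩
  · apply Units.ext
    simpa [Units.coe_prod] using hdet
  · rw [diag_apply]
    exact hM

theorem isMonomial_s {ℓ : ℕ} (k : Fin (ℓ - 1)) : IsMonomial (s k) (adjSwap k) := by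
  intro i j
  have h := lo_ne_hi k
  simp only [s, sMatrix, adjSwap, Equiv.swap_apply_def]
  grind

/-- A non-zero entry at `(i, j)` forces `t j = t' i`, so each row has at most one. Invertibility
puts one in every row and column. -/
theorem IsMonomial.of_mul_eq {ℓ : ℕ} {M : SL(ℓ, ℂ)} {t t' : tuples ℓ}
    (ht : Function.Injective t.1) (h : M * diag ℓ t = diag ℓ t' * M) :
    ∃ p, IsMonomial M p := by
  have hent : ∀ i j, M.1 i j ≠ 0 → t.1 j = t'.1 i := by
    intro i j hij
    have h1 : (M.1 * Matrix.diagonal fun i => ((t.1 i : ℂˣ) : ℂ)) i j =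
        ((Matrix.diagonal fun i => ((t'.1 i : ℂˣ) : ℂ)) * M.1) i j :=
      congrArg (fun X : SL(ℓ, ℂ) => X.1 i j) h
    rw [Matrix.mul_diagonal, Matrix.diagonal_mul, mul_comm] at h1
    exact Units.ext (mul_right_cancel₀ hij h1)
  have hrow : ∀ i, ∃ j, M.1 i j ≠ 0 := by
    intro i
    by_contra! hc
    have := Matrix.det_eq_zero_of_row_eq_zero i hc
    rw [M.2] at this
    exact one_ne_zero this
  have hcol : ∀ j, ∃ i, M.1 i j ≠ 0 := by
    intro j
    by_contra! hc
    have := Matrix.det_eq_zero_of_column_eq_zero j hc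
    rw [M.2] at this
    exact one_ne_zero this
  choose q hq using hrow
  have huniq : ∀ i j, M.1 i j ≠ 0 → j = q i := fun i j hij =>
    ht ((hent i j hij).trans (hent i _ (hq i)).symm)
  have hsurj : Function.Surjective q := fun j => by
    obtain ⟨i, hi⟩ := hcol j
    exact ⟨i, (huniq i j hi).symm⟩
  let e : Equiv.Perm (Fin ℓ) := Equiv.ofBijective q (Finite.surjective_iff_bijective.1 hsurj)
  -- `e` sends rows to columns, whereas `IsMonomial` sends columns to rows.
  refine ⟨e⁻¹, fun i j => ?_⟩
  rw [Equiv.Perm.eq_inv_iff_eq]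
  refine ⟨fun hij => (huniq i j hij).symm, fun hij => ?_⟩
  rw [← hij]
  exact hq i

section group

variable {ℓ : ℕ} {G : Type*} [Group G] {π : SL(ℓ, ℂ) →* G}

/-! ### Passing from `SL_ℓ` to `G`: the Weyl group as symmetric group -/

theorem exists_diag_eq_of_mem_ker (hker : π.ker ≤ Subgroup.center SL(ℓ, ℂ)) {z : SL(ℓ, ℂ)}
    (hz : π z = 1) : ∃ r : ℂ, z.1 = Matrix.diagonal fun _ => r := by
  obtain ⟨r, -, hr⟩ := Matrix.SpecialLinearGroup.mem_center_iff.1 (hker hz)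
  exact ⟨r, by rw [← hr]; rfl⟩

theorem IsMonomial.of_map_eq (hker : π.ker ≤ Subgroup.center SL(ℓ, ℂ)) {M M' : SL(ℓ, ℂ)}
    (h : π M = π M') {p : Equiv.Perm (Fin ℓ)} (hM : IsMonomial M p) : IsMonomial M' p := by
  have hz : π (M⁻¹ * M') = 1 := by rw [map_mul, map_inv, h, inv_mul_cancel]
  obtain ⟨r, hr⟩ := exists_diag_eq_of_mem_ker hker hz
  have h1 : IsMonomial (M⁻¹ * M') 1 := by
    have hdet := (M⁻¹ * M').2
    rw [hr, Matrix.det_diagonal] at hdet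
    intro i j
    rw [hr, Matrix.diagonal_apply]
    have : r ≠ 0 := by
      rintro rfl
      rw [Finset.prod_eq_zero (Finset.mem_univ i) rfl] at hdet
      exact zero_ne_one hdet
    simp [this]
  simpa using hM.mul h1

/-- Conjugating a regular diagonal matrix by `M` gives a diagonal matrix up to an element of the
kernel. That element is scalar, so the conjugate is itself diagonal. -/
theorem exists_isMonomial (hsurj : Function.Surjective π)
    (hker : π.ker ≤ Subgroup.center SL(ℓ, ℂ)) (n : N π) :
    ∃ p, ∀ M, π M = n → IsMonomial M p := by
  obtain ⟨M, hM⟩ := hsurj n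
  obtain ⟨t, ht⟩ := exists_injective_tuple ℓ
  have hn := (Subgroup.mem_normalizer_iff.1 n.2 (param π t)).1 ⟨t, rfl⟩
  obtain ⟨t', ht'⟩ := hn
  have hz : π ((diag ℓ t')⁻¹ * (M * diag ℓ t * M⁻¹)) = 1 := by
    simp only [map_mul, map_inv, hM]
    rw [inv_mul_eq_one]
    exact ht'
  have hmon : IsMonomial ((diag ℓ t')⁻¹ * (M * diag ℓ t * M⁻¹)) 1 :=
    IsMonomial.of_map_eq (p := 1) hker (hz.trans (map_one π).symm).symm
      (by simpa using isMonomial_diag (1 : tuples ℓ))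
  obtain ⟨t'', ht''⟩ := hmon.exists_diag
  have heq : M * diag ℓ t = diag ℓ (t' * t'') * M := by
    rw [map_mul, ← ht'']
    group
  obtain ⟨p, hp⟩ := IsMonomial.of_mul_eq ht heq
  exact ⟨p, fun M' hM' => hp.of_map_eq hker (hM.trans hM'.symm)⟩

/-- The permutation of the coordinates defined by an element of `N_G(A)`. -/
noncomputable def permHom (hsurj : Function.Surjective π)
    (hker : π.ker ≤ Subgroup.center SL(ℓ, ℂ)) : N π →* Equiv.Perm (Fin ℓ) :=
  MonoidHom.mk' (fun n => (exists_isMonomial hsurj hker n).choose) fun a b => by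
    obtain ⟨x, hx⟩ := hsurj a
    obtain ⟨y, hy⟩ := hsurj b
    have ha := (exists_isMonomial hsurj hker a).choose_spec x hx
    have hb := (exists_isMonomial hsurj hker b).choose_spec y hy
    have hab := (exists_isMonomial hsurj hker (a * b)).choose_spec (x * y) (by simp [hx, hy])
    exact hab.unique (ha.mul hb)

theorem isMonomial_permHom (hsurj : Function.Surjective π)
    (hker : π.ker ≤ Subgroup.center SL(ℓ, ℂ)) {n : N π} {M : SL(ℓ, ℂ)} (h : π M = n) :
    IsMonomial M (permHom hsurj hker n) :=
  (exists_isMonomial hsurj hker n).choose_spec M h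

theorem permHom_s (hsurj : Function.Surjective π)
    (hker : π.ker ≤ Subgroup.center SL(ℓ, ℂ)) (k : Fin (ℓ - 1)) :
    permHom hsurj hker ⟨π (s k), map_s_mem π k⟩ = adjSwap k :=
  (isMonomial_permHom hsurj hker rfl).unique (isMonomial_s k)

theorem ker_permHom (hsurj : Function.Surjective π)
    (hker : π.ker ≤ Subgroup.center SL(ℓ, ℂ)) :
    (permHom hsurj hker).ker = (A π).subgroupOf (N π) := by
  ext n
  rw [MonoidHom.mem_ker, Subgroup.mem_subgroupOf]
  obtain ⟨M, hM⟩ := hsurj n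
  have hmon := isMonomial_permHom hsurj hker hM
  constructor
  · intro h
    rw [h] at hmon
    obtain ⟨t, rfl⟩ := hmon.exists_diag
    exact ⟨t, hM⟩
  · rintro ⟨t, ht⟩
    exact (isMonomial_permHom hsurj hker ht).unique (isMonomial_diag t)

theorem permHom_surjective (hsurj : Function.Surjective π)
    (hker : π.ker ≤ Subgroup.center SL(ℓ, ℂ)) : Function.Surjective (permHom hsurj hker) := by
  rw [← MonoidHom.range_eq_top, eq_top_iff, ← closure_adjSwap, Subgroup.closure_le]
  rintro _ ⟨k, rfl⟩
  exact ⟨_, permHom_s hsurj hker k⟩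

/-- The Weyl group is the symmetric group. -/
noncomputable def weylEquiv (hsurj : Function.Surjective π)
    (hker : π.ker ≤ Subgroup.center SL(ℓ, ℂ)) : W π ≃* Equiv.Perm (Fin ℓ) :=
  (QuotientGroup.quotientMulEquivOfEq (ker_permHom hsurj hker).symm).trans
    (QuotientGroup.quotientKerEquivOfSurjective _ (permHom_surjective hsurj hker))

theorem weylEquiv_simpleReflection (hsurj : Function.Surjective π)
    (hker : π.ker ≤ Subgroup.center SL(ℓ, ℂ)) (k : Fin (ℓ - 1)) :
    weylEquiv hsurj hker (simpleReflection π k) = adjSwap k :=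
  permHom_s hsurj hker k

theorem weylEquiv_mem_closure_iff (hsurj : Function.Surjective π)
    (hker : π.ker ≤ Subgroup.center SL(ℓ, ℂ)) (θ : Set (Fin (ℓ - 1))) (w : W π) :
    weylEquiv hsurj hker w ∈ Subgroup.closure (adjSwap '' θ) ↔ w ∈ parabolic π θ := by
  have h : (parabolic π θ).map (weylEquiv hsurj hker).toMonoidHom =
      Subgroup.closure (adjSwap '' θ) := by
    rw [parabolic, MonoidHom.map_closure, Set.image_image]
    congr 1
    exact Set.image_congr fun k _ => weylEquiv_simpleReflection hsurj hker k
  rw [← h]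
  exact Subgroup.mem_map_iff_mem (weylEquiv hsurj hker).injective

theorem isConj_weylEquiv_iff (hsurj : Function.Surjective π)
    (hker : π.ker ≤ Subgroup.center SL(ℓ, ℂ)) (u w : W π) :
    IsConj (weylEquiv hsurj hker u) (weylEquiv hsurj hker w) ↔ IsConj u w := by
  refine ⟨fun h => ?_, fun h => (weylEquiv hsurj hker).toMonoidHom.map_isConj h⟩
  simpa using (weylEquiv hsurj hker).symm.toMonoidHom.map_isConj h

theorem isElliptic_iff_isFullCycle (hℓ : 2 ≤ ℓ) (hsurj : Function.Surjective π)
    (hker : π.ker ≤ Subgroup.center SL(ℓ, ℂ)) (w : W π) :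
    IsElliptic π w ↔ IsFullCycle (weylEquiv hsurj hker w) := by
  rw [isFullCycle_iff_forall_conj _ hℓ]
  refine forall_congr' fun θ => forall_congr' fun _ => ?_
  rw [(weylEquiv hsurj hker).surjective.forall]
  refine forall_congr' fun u => ?_
  rw [isConj_weylEquiv_iff, weylEquiv_mem_closure_iff]

theorem isElliptic_iff_isConj_coxeterElement (hℓ : 2 ≤ ℓ) (hsurj : Function.Surjective π)
    (hker : π.ker ≤ Subgroup.center SL(ℓ, ℂ)) (w : W π) :
    IsElliptic π w ↔ IsConj (coxeterElement π) w := by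
  have h : weylEquiv hsurj hker (coxeterElement π) = (List.ofFn (adjSwap (ℓ := ℓ))).prod := by
    rw [coxeterElement, map_list_prod, List.map_ofFn]
    congr 2
    funext k
    exact weylEquiv_simpleReflection hsurj hker k
  rw [isElliptic_iff_isFullCycle hℓ hsurj hker, ← isConj_weylEquiv_iff hsurj hker, h,
    (isFullCycle_prod_adjSwap hℓ).isConj_iff hℓ]

end group

/-! ### Eigenvalues of monomial matrices attached to full cycles -/

section cyclic

variable {ℓ : ℕ} {M : SL(ℓ, ℂ)} {p : Equiv.Perm (Fin ℓ)}

theorem IsMonomial.pow (hM : IsMonomial M p) (k : ℕ) : IsMonomial (M ^ k) (p ^ k) := by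
  induction k with
  | zero => simpa using isMonomial_diag (1 : tuples ℓ)
  | succ k ih => rw [pow_succ, pow_succ]; exact ih.mul hM

/-- `M ^ ℓ` is diagonal because `p ^ ℓ = 1`. It commutes with `M`, so its entries are constant along
the single cycle of `p`. -/
theorem IsMonomial.exists_pow_eq (hℓ : 2 ≤ ℓ) (hM : IsMonomial M p) (hp : IsFullCycle p) :
    ∃ a : ℂ, M.1 ^ ℓ = Matrix.diagonal fun _ => a := by
  have h1 := hM.pow ℓ
  have h0 : p ^ ℓ = 1 := orderOf_dvd_iff_pow_eq_one.1 (hp.orderOf hℓ).dvd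
  rw [h0] at h1
  obtain ⟨t, ht⟩ := h1.exists_diag
  have hstep : ∀ j, t.1 (p j) = t.1 j := by
    intro j
    have hc : M * diag ℓ t = diag ℓ t * M := by
      rw [← ht, ← pow_succ, ← pow_succ']
    have h2 : (M.1 * Matrix.diagonal fun i => ((t.1 i : ℂˣ) : ℂ)) (p j) j =
        ((Matrix.diagonal fun i => ((t.1 i : ℂˣ) : ℂ)) * M.1) (p j) j :=
      congrArg (fun X : SL(ℓ, ℂ) => X.1 (p j) j) hc
    rw [Matrix.mul_diagonal, Matrix.diagonal_mul, mul_comm] at h2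
    exact Units.ext (mul_right_cancel₀ ((hM _ _).2 rfl) h2).symm
  have hpow : ∀ (k : ℕ) j, t.1 ((p ^ k) j) = t.1 j := by
    intro k
    induction k with
    | zero => simp
    | succ k ih => intro j; rw [pow_succ, Equiv.Perm.mul_apply, ih, hstep]
  let o : Fin ℓ := ⟨0, by omega⟩
  refine ⟨t.1 o, ?_⟩
  have h3 : M.1 ^ ℓ = (M ^ ℓ).1 := by simp
  rw [h3, ht, diag_apply]
  congr 1
  funext i
  obtain ⟨k, -, hk⟩ := (hp o i).exists_pow_eq'
  rw [← hk, hpow]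

/-- The eigenvector is the average `∑ μ⁻ᵏ Mᵏ e_o` over `k < ℓ`: applying `M` shifts the terms
cyclically and multiplies by `μ`. -/
theorem IsMonomial.exists_eigenvector (hℓ : 2 ≤ ℓ) (hM : IsMonomial M p) (hp : IsFullCycle p)
    {a μ : ℂ} (ha : M.1 ^ ℓ = Matrix.diagonal fun _ => a) (hμ : μ ^ ℓ = a) (hμ0 : μ ≠ 0) :
    ∃ x : Fin ℓ → ℂ, x ≠ 0 ∧ M.1.mulVec x = μ • x := by
  let o : Fin ℓ := ⟨0, by omega⟩
  let f : ℕ → Fin ℓ → ℂ := fun k => (μ ^ k)⁻¹ • (M.1 ^ k).mulVec (Pi.single o 1)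
  have hf : ∀ k, M.1.mulVec (f k) = μ • f (k + 1) := by
    intro k
    simp only [f]
    rw [Matrix.mulVec_smul, Matrix.mulVec_mulVec, ← pow_succ', smul_smul]
    congr 1
    rw [pow_succ]
    field_simp
  have hfl : f ℓ = f 0 := by
    simp only [f]
    rw [ha, hμ]
    have ha0 : a ≠ 0 := by rw [← hμ]; exact pow_ne_zero _ hμ0
    ext i
    rw [Pi.smul_apply, Matrix.mulVec_diagonal, pow_zero, pow_zero, Matrix.one_mulVec]
    simp [ha0]
  refine ⟨∑ k ∈ Finset.range ℓ, f k, fun h0 => ?_, ?_⟩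
  · have h1 := congrFun h0 o
    -- For `0 < k < ℓ` the full cycle moves `o` under `p ^ k`, so only the term `k = 0` contributes
    -- to the coordinate `o`.
    rw [Finset.sum_apply, Finset.sum_eq_single 0] at h1
    · simp [f] at h1
    · intro k hk hk0
      have h2 : (M.1 ^ k) o o = 0 := by
        have h3 : M.1 ^ k = (M ^ k).1 := by simp
        rw [h3]
        by_contra h4
        have h5 : (p ^ k) o = o := ((hM.pow k o o).1 h4).symm
        rw [← (hp.isCycle hℓ).pow_eq_one_iff' (hp.apply_ne hℓ o)] at h5
        have h6 := orderOf_dvd_of_pow_eq_one h5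
        rw [hp.orderOf hℓ] at h6
        have := Nat.le_of_dvd (by omega) h6
        rw [Finset.mem_range] at hk
        omega
      simp [f, h2]
    · intro h
      simp at h
      omega
  · rw [Matrix.mulVec_sum]
    simp only [hf]
    rw [← Finset.smul_sum]
    congr 1
    have h1 := Finset.sum_range_succ f ℓ
    rw [Finset.sum_range_succ', hfl] at h1
    exact add_right_cancel h1

theorem IsMonomial.exists_diagonalization (hℓ : 2 ≤ ℓ) (hM : IsMonomial M p)
    (hp : IsFullCycle p) {a : ℂ} (ha : M.1 ^ ℓ = Matrix.diagonal fun _ => a) {t : Fin ℓ → ℂ}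
    (ht : Function.Injective t) (hta : ∀ i, t i ^ ℓ = a) (ht0 : ∀ i, t i ≠ 0) :
    ∃ P : SL(ℓ, ℂ), M.1 * P.1 = P.1 * Matrix.diagonal t := by
  choose x hx0 hx using fun i => hM.exists_eigenvector hℓ hp ha (hta i) (ht0 i)
  have hli : LinearIndependent ℂ x := by
    refine Module.End.eigenvectors_linearIndependent' (Matrix.toLin' M.1) t ht x fun i => ?_
    rw [Module.End.hasEigenvector_iff, Module.End.mem_eigenspace_iff]
    exact ⟨by rw [Matrix.toLin'_apply, hx], hx0 i⟩
  let Q : Matrix (Fin ℓ) (Fin ℓ) ℂ := (Matrix.of x).transpose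
  have hQ : M.1 * Q = Q * Matrix.diagonal t := by
    ext i j
    rw [Matrix.mul_diagonal]
    have := congrFun (hx j) i
    rw [Pi.smul_apply, smul_eq_mul, mul_comm] at this
    exact this
  have hdet : Q.det ≠ 0 := by
    have : IsUnit Q := Matrix.linearIndependent_cols_iff_isUnit.1 hli
    exact ((Matrix.isUnit_iff_isUnit_det _).1 this).ne_zero
  -- Rescaling the eigenbasis gives determinant one.
  obtain ⟨δ, hδ⟩ := IsAlgClosed.exists_pow_nat_eq Q.det⁻¹ (n := ℓ) (by omega)
  refine ⟨⟨δ • Q, ?_⟩, ?_⟩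
  · rw [Matrix.det_smul, Fintype.card_fin, hδ, inv_mul_cancel₀ hdet]
  · change M.1 * (δ • Q) = (δ • Q) * _
    rw [Matrix.mul_smul, hQ, Matrix.smul_mul]

theorem pow_ne_zero_of_eq_diagonal (hℓ : 2 ≤ ℓ) {a : ℂ}
    (ha : M.1 ^ ℓ = Matrix.diagonal fun _ => a) : a ≠ 0 := by
  rintro rfl
  have h := congrArg Matrix.det ha
  rw [Matrix.det_pow, M.2, one_pow, Matrix.det_diagonal, Finset.prod_const, Finset.card_univ,
    Fintype.card_fin, zero_pow (by omega)] at h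
  exact one_ne_zero h

theorem exists_injective_pow_eq (hℓ : 2 ≤ ℓ) {a : ℂ} (ha : a ≠ 0) :
    ∃ t : Fin ℓ → ℂ, Function.Injective t ∧ (∀ i, t i ^ ℓ = a) ∧
      ∏ i, t i = (-1) ^ (ℓ - 1) * a := by
  -- The roots are `β * η ^ (ℓ - 1 - 2 * i)` with `η` primitive of order `2 * ℓ`. The exponents sum
  -- to zero, so the product is `β ^ ℓ`; the sign in `β ^ ℓ` cancels `η ^ (ℓ * (ℓ - 1 - 2 * i)) =
  -- (-1) ^ (ℓ - 1)`.
  obtain ⟨β, hβ⟩ := IsAlgClosed.exists_pow_nat_eq ((-1) ^ (ℓ - 1) * a) (n := ℓ) (by omega)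
  have hβ0 : β ≠ 0 := by
    rintro rfl
    rw [zero_pow (by omega)] at hβ
    exact mul_ne_zero (pow_ne_zero _ (by norm_num)) ha hβ.symm
  have hη := Complex.isPrimitiveRoot_exp (2 * ℓ) (by omega)
  set η := Complex.exp (2 * Real.pi * Complex.I / (2 * ℓ : ℕ))
  have hη0 : η ≠ 0 := Complex.exp_ne_zero _
  have hηl : η ^ ℓ = -1 := by
    have h2 := hη.pow (by omega) (show 2 * ℓ = ℓ * 2 by ring)
    exact h2.eq_neg_one_of_two_right
  let y : ℂˣ := Units.mk0 η hη0
  refine ⟨fun i => β * ((rhoTuple ℓ 1 y).1 i : ℂˣ), fun i j hij => ?_, fun i => ?_, ?_⟩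
  · have h1 := mul_left_cancel₀ hβ0 hij
    rw [rhoTuple_apply, rhoTuple_apply] at h1
    simp only [one_mul, Units.val_zpow_eq_zpow_val, y, Units.val_mk0] at h1
    have h2 : η ^ (twoRho i - twoRho j) = 1 := by
      rw [zpow_sub₀ hη0, h1, div_self (zpow_ne_zero _ hη0)]
    rw [hη.zpow_eq_one_iff_dvd] at h2
    obtain ⟨c, hc⟩ := h2
    simp only [twoRho] at hc
    push_cast at hc
    have h3 : (j : ℤ) - i = ℓ * c := by linarith
    have hc0 : c = 0 := by
      have hi := i.2
      have hj := j.2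
      by_contra hne
      rcases lt_or_gt_of_ne hne with h | h <;> nlinarith
    subst hc0
    exact Fin.ext (by omega)
  · beta_reduce
    rw [rhoTuple_apply, mul_pow, hβ]
    simp only [one_mul, Units.val_zpow_eq_zpow_val, y, Units.val_mk0]
    rw [← zpow_natCast (η ^ _), ← zpow_mul, mul_comm (twoRho i), zpow_mul, zpow_natCast, hηl]
    have h4 : twoRho i = ((ℓ - 1 : ℕ) : ℤ) - 2 * (i : ℤ) := by
      simp only [twoRho]; omega
    rw [h4, zpow_sub₀ (by norm_num), zpow_mul, zpow_natCast]
    norm_num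
    rw [mul_comm, ← mul_assoc, ← mul_pow]
    norm_num
  · rw [Finset.prod_mul_distrib, Finset.prod_const, Finset.card_univ, Fintype.card_fin, hβ,
      ← Units.coe_prod]
    have h5 : ∏ i, (rhoTuple ℓ 1 y).1 i = 1 := (rhoTuple ℓ 1 y).2
    rw [h5, Units.val_one, mul_one]

/-- `M` is similar to the diagonal matrix of all `ℓ`-th roots of the scalar `a`, so `1 = det M =
(-1) ^ (ℓ - 1) * a`. -/
theorem IsMonomial.pow_eq (hℓ : 2 ≤ ℓ) (hM : IsMonomial M p) (hp : IsFullCycle p) :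
    M.1 ^ ℓ = Matrix.diagonal fun _ => (-1) ^ (ℓ - 1) := by
  obtain ⟨a, ha⟩ := hM.exists_pow_eq hℓ hp
  have ha0 := pow_ne_zero_of_eq_diagonal hℓ ha
  obtain ⟨t, ht, hta, htp⟩ := exists_injective_pow_eq hℓ ha0
  obtain ⟨P, hP⟩ := hM.exists_diagonalization hℓ hp ha ht hta fun i h => by
    have := hta i
    rw [h, zero_pow (by omega)] at this
    exact ha0 this.symm
  have hdet := congrArg Matrix.det hP
  rw [Matrix.det_mul, Matrix.det_mul, M.2, P.2, Matrix.det_diagonal, htp] at hdet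
  have : a = (-1) ^ (ℓ - 1) := by
    have h2 : ((-1 : ℂ) ^ (ℓ - 1)) * (-1) ^ (ℓ - 1) = 1 := by rw [← mul_pow]; norm_num
    linear_combination (-a) * h2 - (-1 : ℂ) ^ (ℓ - 1) * hdet
  rw [ha, this]

/-- Each of the `ℓ` distinct roots is an eigenvalue of `M`, hence an entry of `t`; counting shows
that there is no room for repetition. -/
theorem IsMonomial.injective_of_semiconj (hℓ : 2 ≤ ℓ) (hM : IsMonomial M p) (hp : IsFullCycle p)
    {h : SL(ℓ, ℂ)} {t : Fin ℓ → ℂ} (heq : h.1 * M.1 = Matrix.diagonal t * h.1) :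
    Function.Injective t ∧ ∀ i, t i ^ ℓ = (-1) ^ (ℓ - 1) := by
  have ha := hM.pow_eq hℓ hp
  have ha0 := pow_ne_zero_of_eq_diagonal hℓ ha
  obtain ⟨u, hu, hua, -⟩ := exists_injective_pow_eq hℓ ha0
  have hex : ∀ k, ∃ i, t i = u k := by
    intro k
    have huk : u k ≠ 0 := fun h0 => by
      have := hua k
      rw [h0, zero_pow (by omega)] at this
      exact ha0 this.symm
    obtain ⟨x, hx0, hx⟩ := hM.exists_eigenvector hℓ hp ha (hua k) huk
    have hy0 : h.1.mulVec x ≠ 0 := fun h0 =>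
      hx0 (Matrix.eq_zero_of_mulVec_eq_zero (by rw [h.2]; exact one_ne_zero) h0)
    obtain ⟨i, hi⟩ := Function.ne_iff.1 hy0
    refine ⟨i, ?_⟩
    have h1 : (Matrix.diagonal t).mulVec (h.1.mulVec x) = u k • h.1.mulVec x := by
      rw [Matrix.mulVec_mulVec, ← heq, ← Matrix.mulVec_mulVec, hx, Matrix.mulVec_smul]
    have h2 := congrFun h1 i
    rw [Matrix.mulVec_diagonal, Pi.smul_apply, smul_eq_mul] at h2
    exact mul_right_cancel₀ hi h2
  choose g hg using hex
  have hginj : Function.Injective g := fun a b hab => hu (by rw [← hg, ← hg, hab])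
  have hgbij := Finite.injective_iff_bijective.1 hginj
  constructor
  · intro i j hij
    obtain ⟨a, rfl⟩ := hgbij.2 i
    obtain ⟨b, rfl⟩ := hgbij.2 j
    rw [hg, hg] at hij
    rw [hu hij]
  · intro i
    obtain ⟨a, rfl⟩ := hgbij.2 i
    rw [hg, hua]

end cyclic

/-! ### Simple roots and the constants `b_γ` -/

theorem sum_rootVec_mul {ℓ : ℕ} (i j : Fin ℓ) (v : Fin ℓ → ℝ) :
    ∑ a, (rootVec i j a : ℝ) * v a = v i - v j := by
  simp [rootVec, sub_mul, Finset.sum_sub_distrib, Pi.single_apply]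

theorem sum_simpleRoot_mul {ℓ : ℕ} (k : Fin (ℓ - 1)) (v : Fin ℓ → ℝ) :
    ∑ a, (simpleRoot k a : ℝ) * v a = v (lo k) - v (hi k) :=
  sum_rootVec_mul _ _ v

theorem coweight_lo_sub_hi {ℓ : ℕ} (k j : Fin (ℓ - 1)) :
    coweight k (lo j) - coweight k (hi j) = if k = j then 1 else 0 := by
  simp only [coweight, lo, hi, Fin.le_def, Fin.ext_iff]
  split_ifs <;> first | omega | simp

/-- A vector `i ↦ g (i + 1) - g i` with `g 0 = g ℓ = 0` is the combination of the simple roots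
with coefficients `g (k + 1)`. -/
theorem sum_smul_simpleRoot {ℓ : ℕ} (g : ℕ → ℤ) (h0 : g 0 = 0) (hl : g ℓ = 0) :
    ∑ k : Fin (ℓ - 1), g (k + 1) • simpleRoot k = fun i : Fin ℓ => g (i + 1) - g i := by
  funext i
  simp only [Finset.sum_apply, Pi.smul_apply, simpleRoot, rootVec, Pi.sub_apply, smul_eq_mul,
    mul_sub, Finset.sum_sub_distrib]
  congr 1
  · by_cases hi : (i : ℕ) < ℓ - 1
    · rw [Finset.sum_eq_single ⟨i, hi⟩]
      · simp [lo]
      · intro k _ hk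
        rw [Pi.single_apply, if_neg, mul_zero]
        rintro rfl
        exact hk rfl
      · simp
    · have : (i : ℕ) + 1 = ℓ := by omega
      rw [this, hl]
      refine Finset.sum_eq_zero fun k _ => ?_
      rw [Pi.single_apply, if_neg, mul_zero]
      rintro rfl
      exact hi k.2
  · by_cases hi0 : (i : ℕ) = 0
    · rw [hi0, h0]
      refine Finset.sum_eq_zero fun k _ => ?_
      rw [Pi.single_apply, if_neg, mul_zero]
      rintro rfl
      simp [hi] at hi0
    · have hlt : (i : ℕ) - 1 < ℓ - 1 := by omega
      have hhi : i = hi ⟨i - 1, hlt⟩ := Fin.ext (by simp [hi]; omega)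
      rw [Finset.sum_eq_single ⟨i - 1, hlt⟩]
      · rw [← hhi, Pi.single_eq_same, mul_one]
        congr 1
        simp
        omega
      · intro k _ hk
        rw [Pi.single_apply, if_neg, mul_zero]
        rintro rfl
        exact hk (Fin.ext (by simp [hi]))
      · simp

theorem rootVec_eq_sum {ℓ : ℕ} (i j : Fin ℓ) :
    rootVec i j = ∑ k : Fin (ℓ - 1),
      ((if i ≤ lo k then 1 else 0) - (if j ≤ lo k then 1 else 0) : ℤ) • simpleRoot k := by
  have h := sum_smul_simpleRoot (ℓ := ℓ)
    (fun m => (if (i : ℕ) < m then 1 else 0) - (if (j : ℕ) < m then 1 else 0)) (by simp) (by simp)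
  have h' : rootVec i j = fun a : Fin ℓ =>
      ((if (i : ℕ) < a + 1 then 1 else 0) - (if (j : ℕ) < a + 1 then 1 else 0) : ℤ) -
      ((if (i : ℕ) < a then 1 else 0) - (if (j : ℕ) < a then 1 else 0)) := by
    funext a
    simp only [rootVec, Pi.sub_apply, Pi.single_apply, Fin.ext_iff]
    split_ifs <;> omega
  rw [h', ← h]
  refine Finset.sum_congr rfl fun k _ => ?_
  simp only [lo, Fin.le_def, Nat.lt_succ_iff]

theorem isHighestRoot_sum_simpleRoot {ℓ : ℕ} (hℓ : 2 ≤ ℓ) :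
    IsHighestRoot (∑ k : Fin (ℓ - 1), simpleRoot k) := by
  have h0 : (∑ k : Fin (ℓ - 1), simpleRoot k) =
      rootVec ⟨0, by omega⟩ ⟨ℓ - 1, by omega⟩ := by
    rw [rootVec_eq_sum]
    refine Finset.sum_congr rfl fun k _ => ?_
    have := k.2
    rw [if_pos (by simp [Fin.le_def]), if_neg (by simp [Fin.le_def, lo]; omega)]
    simp
  refine ⟨⟨_, _, by simp [Fin.ext_iff]; omega, h0⟩, ?_⟩
  rintro _ ⟨i, j, -, rfl⟩
  refine ⟨fun k => (1 - ((if i ≤ lo k then 1 else 0) - (if j ≤ lo k then 1 else 0)) : ℤ).toNat, ?_⟩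
  rw [rootVec_eq_sum, ← Finset.sum_sub_distrib]
  refine Finset.sum_congr rfl fun k _ => ?_
  rw [Int.toNat_of_nonneg (by split_ifs <;> norm_num), sub_smul (1 : ℤ), one_smul]

/-- Pairing with the coweight `k` reads off `c k`, and two coordinates of a coweight differ by at
most `1`. -/
theorem le_one_of_isRoot_sum {ℓ : ℕ} {c : Fin (ℓ - 1) → ℕ}
    (h : IsRoot (∑ k, (c k : ℤ) • simpleRoot k)) (k : Fin (ℓ - 1)) : c k ≤ 1 := by
  obtain ⟨i, j, -, hij⟩ := h
  have h1 : ∑ a, ((∑ k, (c k : ℤ) • simpleRoot k) a : ℝ) * coweight k a = c k := by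
    simp only [Finset.sum_apply, Pi.smul_apply, smul_eq_mul, Int.cast_sum, Int.cast_mul,
      Int.cast_natCast, Finset.sum_mul, mul_assoc]
    rw [Finset.sum_comm]
    simp only [← Finset.mul_sum, sum_simpleRoot_mul, coweight_lo_sub_hi]
    simp
  rw [hij, sum_rootVec_mul] at h1
  have h2 : (c k : ℝ) ≤ 1 := by
    rw [← h1]
    simp only [coweight]
    split_ifs <;> linarith
  exact_mod_cast h2

theorem isB_iff {ℓ : ℕ} (hℓ : 2 ≤ ℓ) (b : Node ℓ → ℕ) : IsB b ↔ ∀ γ, b γ = 1 := by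
  constructor
  · rintro ⟨h0, c, hc, hroot, hb⟩ (_ | k)
    · exact h0
    · have hck : c k = 1 := le_antisymm (le_one_of_isRoot_sum hroot.1 k) (hc k)
      have h := hb k k
      rw [sum_simpleRoot_mul, coweight_lo_sub_hi, if_pos rfl, if_pos rfl, hck, Nat.cast_one,
        div_one] at h
      exact_mod_cast h.symm
  · intro h
    refine ⟨h _, fun _ => 1, fun _ => one_pos, ?_, fun k j => ?_⟩
    · simpa using isHighestRoot_sum_simpleRoot hℓ
    · rw [sum_simpleRoot_mul, coweight_lo_sub_hi, h]
      simp

theorem sum_lo_sub_hi {ℓ : ℕ} (hℓ : 2 ≤ ℓ) (v : Fin ℓ → ℝ) :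
    ∑ k : Fin (ℓ - 1), (v (lo k) - v (hi k)) = v ⟨0, by omega⟩ - v ⟨ℓ - 1, by omega⟩ := by
  obtain ⟨n, rfl⟩ : ∃ n, ℓ = n + 1 := ⟨ℓ - 1, by omega⟩
  let f : ℕ → ℝ := fun m => if h : m < n + 1 then v ⟨m, h⟩ else 0
  have h1 : ∀ i : Fin (n + 1), v i = f i := fun i => by simp only [f, dif_pos i.2]
  simp only [h1, lo, hi]
  exact (Fin.sum_univ_eq_sum_range (fun m => f m - f (m + 1)) n).trans (Finset.sum_range_sub' f n)

/-! ### Cocharacters and Kac diagrams -/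

section group

variable {ℓ : ℕ} {G : Type*} [Group G] {π : SL(ℓ, ℂ) →* G}

/-- The ratio of two diagonal entries is trivial on scalars, so it descends to `A` for every `π`. -/
theorem exists_isCharacter_rootVec (hker : π.ker ≤ Subgroup.center SL(ℓ, ℂ)) (i j : Fin ℓ) :
    ∃ χ : A π →* ℂˣ, IsCharacter π χ (rootVec i j) ∧
      ∀ t, χ ((param π).rangeRestrict t) = t.1 i / t.1 j := by
  let g : tuples ℓ →* ℂˣ :=
    ((Pi.evalMonoidHom _ i).comp (tuples ℓ).subtype) /
      ((Pi.evalMonoidHom _ j).comp (tuples ℓ).subtype)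
  have hg : ∀ t, g t = t.1 i / t.1 j := fun t => rfl
  have hle : (param π).rangeRestrict.ker ≤ g.ker := by
    intro t ht
    rw [MonoidHom.ker_rangeRestrict] at ht
    obtain ⟨r, hr⟩ := exists_diag_eq_of_mem_ker hker (z := diag ℓ t) ht
    rw [diag_apply] at hr
    have hval : ∀ k, ((t.1 k : ℂˣ) : ℂ) = r := fun k => congrFun (Matrix.diagonal_injective hr) k
    rw [MonoidHom.mem_ker, hg, div_eq_one]
    exact Units.ext ((hval i).trans (hval j).symm)
  let χ := (param π).rangeRestrict.liftOfSurjective (param π).rangeRestrict_surjective ⟨g, hle⟩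
  have hχ : ∀ t, χ ((param π).rangeRestrict t) = t.1 i / t.1 j := fun t =>
    (param π).rangeRestrict.liftOfRightInverse_comp_apply _ _ ⟨g, hle⟩ t
  refine ⟨χ, fun t => (hχ t).trans ?_, hχ⟩
  simp only [rootVec, Pi.sub_apply, zpow_sub, Finset.prod_mul_distrib, Finset.prod_inv_distrib]
  rw [Finset.prod_eq_single i, Finset.prod_eq_single j]
  · simp [div_eq_mul_inv]
  · intro k _ hk; simp [hk]
  · simp
  · intro k _ hk; simp [hk]
  · simp

theorem exists_tuple_of_isVectorOf (hker : π.ker ≤ Subgroup.center SL(ℓ, ℂ)) {c : ℂˣ →* A π}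
    {v : Fin ℓ → ℝ} (hc : IsCocharacter π c) (hv : IsVectorOf π c v) (ξ : ℂˣ) :
    ∃ t : tuples ℓ, (c ξ : G) = π (diag ℓ t) ∧
      ∀ i j, ∃ k : ℤ, (k : ℝ) = v i - v j ∧ t.1 i / t.1 j = ξ ^ k := by
  obtain ⟨t, ht⟩ := (param π).rangeRestrict_surjective (c ξ)
  refine ⟨t, by rw [← ht]; rfl, fun i j => ?_⟩
  obtain ⟨χ, hχ, hχt⟩ := exists_isCharacter_rootVec hker i j
  obtain ⟨k, hk⟩ := hc χ _ hχ
  refine ⟨k, ?_, ?_⟩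
  · rw [← hv.2 χ _ k hχ hk, sum_rootVec_mul]
  · rw [← hχt, ht, hk]

theorem exists_sq_eq (z : ℂˣ) : ∃ y : ℂˣ, y ^ 2 = z := by
  obtain ⟨y, hy⟩ := IsAlgClosed.exists_pow_nat_eq (z : ℂ) (n := 2) two_pos
  have hy0 : y ≠ 0 := by
    rintro rfl
    exact z.ne_zero (by rw [← hy]; norm_num)
  exact ⟨Units.mk0 y hy0, Units.ext (by simpa using hy)⟩

/-- The square root of `y ↦ rhoTuple ℓ d y`: every unit is a square, and the ambiguity `y ↦ -y` is
harmless exactly because `-1` is killed in `G`. -/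
theorem exists_cocharacter {d : ℤ} (hd : π (diag ℓ (rhoTuple ℓ d (-1))) = 1) :
    ∃ c : ℂˣ →* A π, IsCocharacter π c ∧
      IsVectorOf π c (fun i => (d : ℝ) * twoRho i / 2) ∧
      ∀ y, (c (y ^ 2) : G) = π (diag ℓ (rhoTuple ℓ d y)) := by
  have hsq : Function.Surjective (powMonoidHom 2 : ℂˣ →* ℂˣ) := exists_sq_eq
  let g : ℂˣ →* A π := (param π).rangeRestrict.comp (rhoTuple ℓ d)
  have hg1 : g (-1) = 1 := Subtype.ext hd
  have hle : (powMonoidHom 2 : ℂˣ →* ℂˣ).ker ≤ g.ker := by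
    intro y hy
    have hy' : (y : ℂ) ^ 2 = 1 := by
      have := congrArg Units.val (show y ^ 2 = 1 from hy)
      simpa using this
    rw [MonoidHom.mem_ker]
    rcases sq_eq_one_iff.1 hy' with h | h
    · rw [show y = 1 from Units.ext h, map_one]
    · rw [show y = -1 from Units.ext (by simpa using h), hg1]
  let c := (powMonoidHom 2 : ℂˣ →* ℂˣ).liftOfSurjective hsq ⟨g, hle⟩
  have hc : ∀ y, c (y ^ 2) = g y := fun y =>
    (powMonoidHom 2 : ℂˣ →* ℂˣ).liftOfRightInverse_comp_apply _ _ ⟨g, hle⟩ y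
  have hχ : ∀ χ e, IsCharacter π χ e → ∀ y, χ (g y) = y ^ ∑ i, d * twoRho i * e i := by
    intro χ e he y
    refine (he _).trans ?_
    simp only [rhoTuple_apply, ← zpow_mul]
    exact prod_zpow_sum _ _ _
  refine ⟨c, fun χ e he => ?_, ⟨?_, fun χ e k he hk => ?_⟩, fun y => by rw [hc]; rfl⟩
  -- Evaluation at `-1` shows that the exponent is even, so its half is the exponent on `z = y ^ 2`.
  · have h1 := hχ χ e he (-1)
    rw [hg1, map_one] at h1
    have heven : Even (∑ i, d * twoRho i * e i) := by
      by_contra hodd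
      rw [Int.not_even_iff_odd] at hodd
      rw [hodd.neg_one_zpow] at h1
      have := congrArg Units.val h1
      norm_num at this
    obtain ⟨k, hk⟩ := heven
    refine ⟨k, fun z => ?_⟩
    obtain ⟨y, rfl⟩ := exists_sq_eq z
    rw [hc, hχ χ e he, hk, ← two_mul, zpow_mul]
    norm_cast
  · have h1 : ((∑ i : Fin ℓ, twoRho i : ℤ) : ℝ) = 0 := by rw [sum_twoRho]; simp
    rw [← Finset.sum_div, ← Finset.mul_sum]
    push_cast at h1
    rw [h1]
    simp
  · have h1 := hχ χ e he (Units.mk0 2 two_ne_zero)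
    rw [← hc, hk, ← zpow_natCast, ← zpow_mul] at h1
    have h2 := congrArg (fun u : ℂˣ => ‖(u : ℂ)‖) h1
    simp only [Units.val_zpow_eq_zpow_val, Units.val_mk0, norm_zpow] at h2
    have h3 := zpow_right_injective₀ (by simp) (by simp) h2
    have h4 : ((2 * k : ℤ) : ℝ) = (∑ i, d * twoRho i * e i : ℤ) := by rw [← h3]; simp
    push_cast at h4
    have h5 : ∑ i, (e i : ℝ) * ((d : ℝ) * twoRho i / 2) = (∑ i, (d : ℝ) * twoRho i * e i) / 2 := by
      rw [Finset.sum_div]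
      exact Finset.sum_congr rfl fun i _ => by ring
    rw [h5, ← h4]
    ring

/-! ### Order and conjugacy class of a lift -/

theorem isOfFinOrder_and_dvd_orderOf (hℓ : 2 ≤ ℓ) (hsurj : Function.Surjective π)
    (hker : π.ker ≤ Subgroup.center SL(ℓ, ℂ)) {n : N π}
    (hp : IsFullCycle (permHom hsurj hker n)) :
    IsOfFinOrder (n : G) ∧ ℓ ∣ orderOf (n : G) := by
  obtain ⟨M, hM⟩ := hsurj n
  have hpow := (isMonomial_permHom hsurj hker hM).pow_eq hℓ hp
  constructor
  · rw [isOfFinOrder_iff_pow_eq_one]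
    refine ⟨ℓ * 2, by omega, ?_⟩
    have h1 : M ^ (ℓ * 2) = 1 := by
      apply Subtype.ext
      have : (M ^ (ℓ * 2)).1 = (M.1 ^ ℓ) ^ 2 := by simp [pow_mul]
      rw [this, hpow, Matrix.diagonal_pow, Matrix.SpecialLinearGroup.coe_one,
        ← Matrix.diagonal_one]
      congr 1
      funext i
      rw [Pi.pow_apply, ← pow_mul, mul_comm, pow_mul]
      norm_num
    rw [← hM, ← map_pow, h1, map_one]
  · refine (hp.orderOf hℓ).symm.dvd.trans ?_
    have h2 : n ^ orderOf (n : G) = 1 := Subtype.ext (by simp [pow_orderOf_eq_one])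
    exact orderOf_dvd_of_pow_eq_one (by rw [← map_pow, h2, map_one])

/-- Both `rhoTuple ℓ d (-1)` and `M ^ (ℓ * d)` are the scalar `(-1) ^ ((ℓ - 1) * d)`, and the latter
dies in `G`. -/
theorem map_rhoTuple_neg_one (hℓ : 2 ≤ ℓ) (hsurj : Function.Surjective π)
    (hker : π.ker ≤ Subgroup.center SL(ℓ, ℂ)) {n : N π}
    (hp : IsFullCycle (permHom hsurj hker n)) {d : ℕ} (hd : orderOf (n : G) = ℓ * d) :
    π (diag ℓ (rhoTuple ℓ d (-1))) = 1 := by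
  obtain ⟨M, hM⟩ := hsurj n
  have hpow := (isMonomial_permHom hsurj hker hM).pow_eq hℓ hp
  have h1 : diag ℓ (rhoTuple ℓ d (-1)) = M ^ (ℓ * d) := by
    apply Subtype.ext
    have : (M ^ (ℓ * d)).1 = (M.1 ^ ℓ) ^ d := by simp [pow_mul]
    rw [this, hpow, Matrix.diagonal_pow, diag_apply]
    congr 1
    funext i
    rw [rhoTuple_apply, Pi.pow_apply, mul_comm, zpow_mul, zpow_natCast]
    have h4 : twoRho i = ((ℓ - 1 : ℕ) : ℤ) - 2 * (i : ℤ) := by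
      simp only [twoRho]; omega
    rw [h4, zpow_sub, zpow_mul, zpow_natCast]
    norm_num
  rw [h1, map_pow, hM, ← hd, pow_orderOf_eq_one]

/-- The entries are distinct since `y ^ (2 * d)` is primitive of order `ℓ`, and their `ℓ`-th powers
are `(-1) ^ (ℓ - 1)`, so they form the spectrum of `M`. -/
theorem isConj_rhoTuple (hℓ : 2 ≤ ℓ) (hsurj : Function.Surjective π)
    (hker : π.ker ≤ Subgroup.center SL(ℓ, ℂ)) {n : N π}
    (hp : IsFullCycle (permHom hsurj hker n)) {d : ℕ}
    (hd0 : 0 < d) {y : ℂˣ} (hy : IsPrimitiveRoot (y ^ 2) (ℓ * d)) :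
    IsConj (n : G) (π (diag ℓ (rhoTuple ℓ d y))) := by
  obtain ⟨M, hM⟩ := hsurj n
  have hmon := isMonomial_permHom hsurj hker hM
  have hpow := hmon.pow_eq hℓ hp
  set t := rhoTuple ℓ d y with ht
  have hζ : IsPrimitiveRoot (y ^ (2 * d)) ℓ := by
    rw [pow_mul]
    exact hy.pow (by positivity) (mul_comm _ _)
  have hti : ∀ i, t.1 i = y ^ (d * (ℓ - 1)) * ((y ^ (2 * d)) ^ (i : ℕ))⁻¹ := by
    intro i
    rw [ht, rhoTuple_apply, ← pow_mul, ← zpow_natCast y, ← zpow_natCast y, ← zpow_neg, ← zpow_add]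
    congr 1
    rw [twoRho]
    push_cast [show 1 ≤ ℓ by omega]
    ring
  have hinj : Function.Injective fun i => ((t.1 i : ℂˣ) : ℂ) := by
    intro i j hij
    have h1 := Units.ext hij
    rw [hti, hti] at h1
    exact Fin.ext (hζ.pow_inj i.2 j.2 (inv_injective (mul_left_cancel h1)))
  have hym : (y ^ (ℓ * d)) ^ (ℓ - 1) = (-1) ^ (ℓ - 1) := by
    have h2 : ((y ^ (ℓ * d) : ℂˣ) : ℂ) ^ 2 = 1 := by
      have h3 := congrArg Units.val hy.pow_eq_one
      rw [← pow_mul, mul_comm, pow_mul] at h3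
      simpa using h3
    rcases Nat.even_or_odd (ℓ - 1) with he | ho
    · obtain ⟨r, hr⟩ := he
      rw [hr, ← two_mul, pow_mul (y ^ (ℓ * d)), pow_mul (-1)]
      have : (y ^ (ℓ * d)) ^ 2 = 1 := Units.ext (by simpa using h2)
      rw [this]
      simp
    · congr 1
      have hev : Even ℓ := by
        have : ℓ = (ℓ - 1) + 1 := by omega
        rw [this]
        exact ho.add_one
      obtain ⟨r, hr⟩ := hev
      rcases sq_eq_one_iff.1 h2 with h | h
      -- With `ℓ = 2 * r`, the value `y ^ (ℓ * d) = 1` would give `y ^ 2` an order dividing `r * d <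
      -- ℓ * d`.
      · exfalso
        have h3 : (y ^ 2) ^ (r * d) = 1 := by
          rw [← pow_mul, ← mul_assoc, two_mul, ← hr]
          exact Units.ext h
        have hr0 : 0 < r := by omega
        have h4 := Nat.le_of_dvd (by positivity) (hy.dvd_of_pow_eq_one _ h3)
        have h5 := Nat.le_of_mul_le_mul_right h4 hd0
        omega
      · exact Units.ext (by simpa using h)
  have htl : ∀ i, ((t.1 i : ℂˣ) : ℂ) ^ ℓ = (-1) ^ (ℓ - 1) := by
    intro i
    have h1 : t.1 i ^ ℓ = (-1) ^ (ℓ - 1) := by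
      rw [hti, mul_pow, inv_pow, pow_right_comm (y ^ (2 * d)), hζ.pow_eq_one, one_pow,
        inv_one, mul_one, ← hym]
      rw [← pow_mul, ← pow_mul]
      congr 1
      ring
    have h2 := congrArg Units.val h1
    simpa using h2
  obtain ⟨P, hP⟩ := hmon.exists_diagonalization hℓ hp hpow hinj htl fun i => (t.1 i).ne_zero
  have h1 : M * P = P * diag ℓ t := Subtype.ext hP
  rw [← hM]
  refine π.map_isConj (isConj_iff.2 ⟨P⁻¹, ?_⟩)
  rw [inv_inv, mul_assoc, h1, inv_mul_cancel_left]

/-- A conjugation in `G` lifts to `SL_ℓ` up to a scalar `r`, which cancels in all ratios. -/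
theorem injective_of_isConj (hℓ : 2 ≤ ℓ) (hsurj : Function.Surjective π)
    (hker : π.ker ≤ Subgroup.center SL(ℓ, ℂ)) {n : N π}
    (hp : IsFullCycle (permHom hsurj hker n)) {t : tuples ℓ}
    (hconj : IsConj (n : G) (π (diag ℓ t))) :
    Function.Injective t.1 ∧ ∀ i j, (t.1 i / t.1 j) ^ ℓ = 1 := by
  obtain ⟨M, hM⟩ := hsurj n
  have hmon := isMonomial_permHom hsurj hker hM
  obtain ⟨g, hg⟩ := isConj_iff.1 hconj
  obtain ⟨h, rfl⟩ := hsurj g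
  have hz : π ((diag ℓ t)⁻¹ * (h * M * h⁻¹)) = 1 := by
    simp only [map_mul, map_inv, hM]
    rw [hg, inv_mul_cancel]
  obtain ⟨r, hr⟩ := exists_diag_eq_of_mem_ker hker hz
  have heq : h * M = diag ℓ t * ((diag ℓ t)⁻¹ * (h * M * h⁻¹)) * h := by group
  have heq' : h.1 * M.1 = (Matrix.diagonal fun i => ((t.1 i : ℂˣ) : ℂ) * r) * h.1 := by
    have h1 := congrArg Subtype.val heq
    rw [Matrix.SpecialLinearGroup.coe_mul, Matrix.SpecialLinearGroup.coe_mul,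
      Matrix.SpecialLinearGroup.coe_mul (diag ℓ t), hr, diag_apply,
      Matrix.diagonal_mul_diagonal] at h1
    exact h1
  obtain ⟨hinj, hpow⟩ := hmon.injective_of_semiconj hℓ hp heq'
  constructor
  · intro i j hij
    exact hinj (by simp only [hij])
  · intro i j
    have h1 := (hpow i).trans (hpow j).symm
    rw [mul_pow, mul_pow] at h1
    have hr0 : r ^ ℓ ≠ 0 := by
      intro h0
      have := hpow i
      rw [mul_pow, h0, mul_zero] at this
      exact pow_ne_zero _ (by norm_num) this.symm
    have h2 := mul_right_cancel₀ hr0 h1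
    rw [div_pow, div_eq_one]
    exact Units.ext (by simpa using h2)

/-! ### Uniqueness and existence of the Kac diagram -/

theorem sum_vertex_apply {b : Node ℓ → ℕ} (hb : ∀ γ, b γ = 1) (τ : Node ℓ → ℕ) (i : Fin ℓ) :
    (∑ γ, ((τ γ * b γ : ℕ) : ℝ) • vertex b γ) i = ∑ k, (τ (some k) : ℝ) * coweight k i := by
  rw [Fintype.sum_option]
  simp [vertex, hb]

theorem sum_vertex_lo_sub_hi {b : Node ℓ → ℕ} (hb : ∀ γ, b γ = 1) (τ : Node ℓ → ℕ)
    (k : Fin (ℓ - 1)) :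
    (∑ γ, ((τ γ * b γ : ℕ) : ℝ) • vertex b γ) (lo k) -
      (∑ γ, ((τ γ * b γ : ℕ) : ℝ) • vertex b γ) (hi k) = τ (some k) := by
  rw [sum_vertex_apply hb, sum_vertex_apply hb, ← Finset.sum_sub_distrib]
  simp only [← mul_sub, coweight_lo_sub_hi]
  simp

theorem card_node (hℓ : 2 ≤ ℓ) : Fintype.card (Node ℓ) = ℓ := by
  simp
  omega

theorem eq_one_of_isKacDiagram (hℓ : 2 ≤ ℓ) (hsurj : Function.Surjective π)
    (hker : π.ker ≤ Subgroup.center SL(ℓ, ℂ)) {n : N π}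
    (hp : IsFullCycle (permHom hsurj hker n)) {ξ : ℂˣ}
    (hξ : IsPrimitiveRoot ξ (orderOf (n : G))) {b σ : Node ℓ → ℕ} (hb : ∀ γ, b γ = 1)
    (hσ : IsKacDiagram π b ξ n σ) (γ : Node ℓ) : σ γ = 1 := by
  obtain ⟨c, v, x, τ, hc, hv, hconj, hx, -, hsum, hx', ⟨D, hD, hDσ⟩, hgcd⟩ := hσ
  obtain ⟨hfin, d, hd⟩ := isOfFinOrder_and_dvd_orderOf hℓ hsurj hker hp
  have hm : 0 < orderOf (n : G) := hfin.orderOf_pos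
  have hd0 : 0 < d := by
    rcases Nat.eq_zero_or_pos d with h | h
    · simp [hd, h] at hm
    · exact h
  have hvτ : v = ∑ γ, ((τ γ * b γ : ℕ) : ℝ) • vertex b γ := by
    have hm' : (orderOf (n : G) : ℝ)⁻¹ ≠ 0 := inv_ne_zero (by exact_mod_cast hm.ne')
    exact smul_right_injective _ hm' (hx.symm.trans hx')
  have hvk : ∀ k, v (lo k) - v (hi k) = τ (some k) := fun k => by
    rw [hvτ]; exact sum_vertex_lo_sub_hi hb τ k
  obtain ⟨t, hct, ht⟩ := exists_tuple_of_isVectorOf hker hc hv ξ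
  rw [hct] at hconj
  obtain ⟨hinj, hpow⟩ := injective_of_isConj hℓ hsurj hker hp hconj
  have hmain : ∀ i j, i ≠ j → ∀ k : ℕ, (k : ℝ) = v i - v j → d ∣ k ∧ ¬ ℓ * d ∣ k := by
    intro i j hij k hk
    obtain ⟨k', hk', hpk⟩ := ht i j
    have hkk : k' = (k : ℤ) := by exact_mod_cast hk'.trans hk.symm
    rw [hkk, zpow_natCast] at hpk
    constructor
    · have h1 := hpow i j
      rw [hpk, ← pow_mul, hξ.pow_eq_one_iff_dvd, hd, mul_comm k] at h1
      exact Nat.dvd_of_mul_dvd_mul_left (by omega) h1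
    · rw [← hd, ← hξ.pow_eq_one_iff_dvd, ← hpk, div_eq_one]
      exact fun h => hij (hinj h)
  simp only [hb, mul_one] at hsum
  have hτs : ∀ k, d ∣ τ (some k) ∧ ¬ ℓ * d ∣ τ (some k) := fun k =>
    hmain _ _ (lo_ne_hi k) _ (hvk k).symm
  rw [hd, Fintype.sum_option] at hsum
  have hdvd : ∀ γ, d ∣ τ γ := by
    rintro (_ | k)
    · have h1 : d ∣ ∑ k, τ (some k) := Finset.dvd_sum fun k _ => (hτs k).1
      exact (Nat.dvd_add_left h1).1 (hsum ▸ Dvd.intro_left _ rfl)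
    · exact (hτs k).1
  have hpos : ∀ γ, τ γ ≠ 0 := by
    rintro (_ | k) h0
    · rw [h0, zero_add] at hsum
      -- If `τ_0 = 0`, the first and last coordinates of `v` differ by `ℓ * d`, so two eigenvalues
      -- coincide.
      refine (hmain ⟨0, by omega⟩ ⟨ℓ - 1, by omega⟩ (by simp [Fin.ext_iff]; omega)
        (∑ k, τ (some k)) ?_).2 (by rw [hsum])
      rw [← sum_lo_sub_hi hℓ]
      simp [hvk]
    · exact (hτs k).2 (by simp [h0])
  have hle : ∀ γ, d ≤ τ γ := fun γ => Nat.le_of_dvd (Nat.pos_of_ne_zero (hpos γ)) (hdvd γ)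
  have heq : ∀ γ, d = τ γ := by
    have h1 : ∑ _γ : Node ℓ, d = ∑ γ, τ γ := by
      rw [Finset.sum_const, Finset.card_univ, card_node hℓ, smul_eq_mul, hsum, Fintype.sum_option]
    have h2 := (Finset.sum_eq_sum_iff_of_le fun γ _ => hle γ).1 h1
    exact fun γ => h2 γ (Finset.mem_univ γ)
  have hconst : ∀ γ', σ γ' = σ γ := fun γ' =>
    Nat.eq_of_mul_eq_mul_left hD (by rw [← hDσ, ← hDσ, ← heq, ← heq])
  have hdvd1 : σ γ ∣ Finset.univ.gcd σ := Finset.dvd_gcd fun γ' _ => (hconst γ').symm.dvd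
  rw [hgcd] at hdvd1
  exact Nat.dvd_one.1 hdvd1

theorem sum_coweight_apply (hℓ : 2 ≤ ℓ) (i : Fin ℓ) :
    ∑ k : Fin (ℓ - 1), coweight k i = (twoRho i : ℝ) / 2 := by
  obtain ⟨n, rfl⟩ : ∃ n, ℓ = n + 1 := ⟨ℓ - 1, by omega⟩
  -- The truncated `m - i` counts the `k < m` with `i ≤ k`.
  have hrange : ∀ m : ℕ, ∑ k ∈ Finset.range m,
      ((if (i : ℕ) ≤ k then (1 : ℝ) else 0) - ((k : ℝ) + 1) / ((n + 1 : ℕ) : ℝ)) =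
      (m - i : ℕ) - (m : ℝ) * (m + 1) / (2 * ((n + 1 : ℕ) : ℝ)) := by
    intro m
    induction m with
    | zero => simp
    | succ m ih =>
      rw [Finset.sum_range_succ, ih]
      split_ifs with h
      · rw [Nat.succ_sub h]
        push_cast
        field_simp
        ring
      · rw [Nat.sub_eq_zero_of_le (by omega), Nat.sub_eq_zero_of_le (by omega)]
        push_cast
        field_simp
        ring
  have h1 := (Fin.sum_univ_eq_sum_range (fun k => (if (i : ℕ) ≤ k then (1 : ℝ) else 0) -
    ((k : ℝ) + 1) / ((n + 1 : ℕ) : ℝ)) n).trans (hrange n)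
  refine Eq.trans ?_ (h1.trans ?_)
  · rfl
  · rw [Nat.cast_sub (by omega), twoRho]
    push_cast
    field_simp
    ring

/-- The point `ρ^∨ / ℓ` is the barycentre of the alcove: all simple roots take the value `1 / ℓ`
there. -/
theorem isKacDiagram_one (hℓ : 2 ≤ ℓ) (hsurj : Function.Surjective π)
    (hker : π.ker ≤ Subgroup.center SL(ℓ, ℂ)) {n : N π}
    (hp : IsFullCycle (permHom hsurj hker n)) {ξ : ℂˣ}
    (hξ : IsPrimitiveRoot ξ (orderOf (n : G))) {b : Node ℓ → ℕ} (hb : ∀ γ, b γ = 1) :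
    IsKacDiagram π b ξ n b := by
  obtain ⟨hfin, d, hd⟩ := isOfFinOrder_and_dvd_orderOf hℓ hsurj hker hp
  have hm : 0 < orderOf (n : G) := hfin.orderOf_pos
  have hd0 : 0 < d := by
    rcases Nat.eq_zero_or_pos d with h | h
    · simp [hd, h] at hm
    · exact h
  obtain ⟨c, hc, hv, hcy⟩ := exists_cocharacter (map_rhoTuple_neg_one hℓ hsurj hker hp hd)
  obtain ⟨y, rfl⟩ := exists_sq_eq ξ
  rw [hd] at hξ
  have hℓ' : (ℓ : ℝ) ≠ 0 := by exact_mod_cast (by omega : ℓ ≠ 0)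
  have hd' : (d : ℝ) ≠ 0 := by exact_mod_cast hd0.ne'
  refine ⟨c, _, _, fun _ => d, hc, hv, ?_, rfl, subset_closure ?_, ?_, ?_, ⟨d, hd0, ?_⟩, ?_⟩
  · rw [hcy]
    exact isConj_rhoTuple hℓ hsurj hker hp hd0 hξ
  · refine ⟨?_, fun i j hij => ?_⟩
    · simp only [Pi.smul_apply]
      rw [← Finset.smul_sum, hv.1, smul_zero]
    · simp only [Pi.smul_apply, smul_eq_mul, hd, twoRho]
      have h1 : ((ℓ * d : ℕ) : ℝ)⁻¹ * (((d : ℤ) : ℝ) * ((ℓ - 1 - 2 * (i : ℤ) : ℤ) : ℝ) / 2) -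
          ((ℓ * d : ℕ) : ℝ)⁻¹ * (((d : ℤ) : ℝ) * ((ℓ - 1 - 2 * (j : ℤ) : ℤ) : ℝ) / 2) =
          ((j : ℕ) - (i : ℕ) : ℝ) / ℓ := by
        push_cast
        field_simp
        ring
      rw [h1]
      have hij' : ((i : ℕ) : ℝ) < (j : ℕ) := by exact_mod_cast hij
      have hj : ((j : ℕ) : ℝ) < ℓ := by exact_mod_cast j.2
      have hi : (0 : ℝ) ≤ (i : ℕ) := Nat.cast_nonneg _
      constructor
      · apply div_pos <;> linarith
      · rw [div_lt_one] <;> linarith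
  · simp only [hb, mul_one]
    rw [Finset.sum_const, Finset.card_univ, card_node hℓ, smul_eq_mul, hd]
  · congr 1
    funext i
    rw [sum_vertex_apply hb, ← Finset.mul_sum, sum_coweight_apply hℓ]
    push_cast
    ring
  · intro γ
    rw [hb, mul_one]
  · refine Nat.dvd_one.1 ?_
    exact (Finset.gcd_dvd (Finset.mem_univ none)).trans (hb none).dvd

end group

end KacA

theorem mainTheorem4 (ℓ : ℕ) (hℓ : 2 ≤ ℓ) {G : Type*} [Group G]
    (π : Matrix.SpecialLinearGroup (Fin ℓ) ℂ →* G) (hsurj : Function.Surjective π)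
    (hker : π.ker ≤ Subgroup.center (Matrix.SpecialLinearGroup (Fin ℓ) ℂ)) :
    -- the elliptic elements form a single conjugacy class, that of the Coxeter element
    (∀ w : KacA.W π, KacA.IsElliptic π w ↔ IsConj (KacA.coxeterElement π) w) ∧
    -- the constants `b_γ` are all equal to one
    (∀ b : KacA.Node ℓ → ℕ, KacA.IsB b ↔ ∀ γ, b γ = 1) ∧
    -- every lift of an elliptic element has finite order, and it has exactly one Kac diagram,
    -- the diagram of the `b_γ`
    (∀ n : KacA.N π, KacA.IsElliptic π (QuotientGroup.mk n) →
      IsOfFinOrder (n : G) ∧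
      ∀ ξ : ℂˣ, IsPrimitiveRoot ξ (orderOf (n : G)) →
        ∀ b : KacA.Node ℓ → ℕ, KacA.IsB b →
          ∀ σ : KacA.Node ℓ → ℕ, KacA.IsKacDiagram π b ξ (n : G) σ ↔ σ = b) := by
  refine ⟨KacA.isElliptic_iff_isConj_coxeterElement hℓ hsurj hker, KacA.isB_iff hℓ, fun n hn => ?_⟩
  have hp : KacA.IsFullCycle (KacA.permHom hsurj hker n) :=
    (KacA.isElliptic_iff_isFullCycle hℓ hsurj hker _).1 hn
  refine ⟨(KacA.isOfFinOrder_and_dvd_orderOf hℓ hsurj hker hp).1, fun ξ hξ b hb σ => ?_⟩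
  have hb1 := (KacA.isB_iff hℓ b).1 hb
  constructor
  · intro hσ
    funext γ
    rw [hb1, KacA.eq_one_of_isKacDiagram hℓ hsurj hker hp hξ hb1 hσ]
  · rintro rfl
    exact KacA.isKacDiagram_one hℓ hsurj hker hp hξ hb1
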